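/- Let $M$ be a connected (finite-dimensional, smooth, Hausdorff, second countable) manifold on which a Lie group $G$ acts smoothly from the left; write $\phi_M(x)$ for the action of $\phi\in G$ on $x\in M$. Let $p\colon P\to M$ be a $G$-equivariant $U(1)$-bundle, i.e. a smooth principal $U(1)$-bundle on which $G$ acts smoothly from the left, $(\phi,y)\mapsto\phi_P(y)$, by principal bundle automorphisms covering the action on $M$, and let $\Xi\in\Omega^1(P,i\mathbb{R})$ be a $G$-invariant connection form on $P$. For $\phi\in G$ let $$\mathcal{C}^{\phi}(M)=\{\gamma\colon[0,1]\to M \mid \gamma \text{ is piecewise } C^1 \text{ and } \gamma(1)=\phi_M(\gamma(0))\},$$ and for $\gamma\in\mathcal{C}^{\phi}(M)$ let the equivariant holonomy $\mathrm{Hol}^{\Xi}_{\phi}(\gamma)\in U(1)$ be the element characterized by $$\overline{\gamma}^{\,y}(1)=\phi_P(y)\cdot\mathrm{Hol}^{\Xi}_{\phi}(\gamma)\qquad\text{for all } y\in p^{-1}(\gamma(0)),$$ where $\overline{\gamma}^{\,y}$ is the $\Xi$-horizontal lift of $\gamma$ with $\overline{\gamma}^{\,y}(0)=y$. Then $P\to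 M$ is trivial as a $G$-equivariant $U(1)$-bundle (that is, there is a $G$-equivariant isomorphism of principal $U(1)$-bundles $M\times U(1)\to P$ covering the identity of $M$, where $G$ acts on $M\times U(1)$ by $\phi\cdot(x,u)=(\phi_M(x),u)$) if and only if there exists a $G$-invariant smooth real $1$-form $\beta\in\Omega^1(M)^G$ such that $$\mathrm{Hol}^{\Xi}_{\phi}(\gamma)=\exp\Bigl(2\pi i\int_{\gamma}\beta\Bigr)\qquad\text{for all }\phi\in G\text{ and all }\gamma\in\mathcal{C}^{\phi}(M).$$ -/

import Mathlib

open scoped Manifold ContDiff Topology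
open Bundle Set

section Forms

variable {E : Type*} [NormedAddCommGroup E] [NormedSpace ℝ E]
  {X : Type*} [TopologicalSpace X] [ChartedSpace E X]

/-- A (not necessarily smooth) `F`-valued 1-form on the manifold `X`: a linear form on each
tangent space. -/
abbrev OneForm (E : Type*) [NormedAddCommGroup E] [NormedSpace ℝ E]
    (X : Type*) [TopologicalSpace X] [ChartedSpace E X]
    (F : Type*) [NormedAddCommGroup F] [NormedSpace ℝ F] : Type _ :=
  ∀ x : X, TangentSpace 𝓘(ℝ, E) x →L[ℝ] F

/-- Smoothness of a 1-form: it is a smooth section of the bundle `Hom(TX, F)`. -/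
def OneForm.IsSmooth [IsManifold 𝓘(ℝ, E) ∞ X]
    {F : Type*} [NormedAddCommGroup F] [NormedSpace ℝ F] (η : OneForm E X F) : Prop :=
  ContMDiff 𝓘(ℝ, E) (𝓘(ℝ, E).prod 𝓘(ℝ, E →L[ℝ] F)) ∞
    (fun x ↦ TotalSpace.mk' (E →L[ℝ] F)
      (E := fun x : X ↦ TangentSpace 𝓘(ℝ, E) x →L[ℝ] F) x (η x))

/-- Invariance `a^* η = η` of a 1-form under all translations `x ↦ a • x`. -/
def OneForm.IsInvariant (A : Type*) [SMul A X]
    {F : Type*} [NormedAddCommGroup F] [NormedSpace ℝ F] (η : OneForm E X F) : Prop :=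
  ∀ (a : A) (x : X) (v : TangentSpace 𝓘(ℝ, E) x),
    η (a • x) (mfderiv 𝓘(ℝ, E) 𝓘(ℝ, E) (fun x' : X ↦ a • x') x v) = η x v

/-- The velocity `γ'(t)` of a curve (zero at the parameters where it is not differentiable). -/
noncomputable def curveVelocity (E : Type*) [NormedAddCommGroup E] [NormedSpace ℝ E]
    {X : Type*} [TopologicalSpace X] [ChartedSpace E X] (γ : ℝ → X) (t : ℝ) :
    TangentSpace 𝓘(ℝ, E) (γ t) :=
  mfderiv 𝓘(ℝ, ℝ) 𝓘(ℝ, E) γ t (1 : ℝ)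

/-- The line integral `∫_γ β` of a real 1-form along a curve `γ : [0,1] → X`. -/
noncomputable def OneForm.lineIntegral (β : OneForm E X ℝ) (γ : ℝ → X) : ℝ :=
  ∫ t in (0 : ℝ)..1, β (γ t) (curveVelocity E γ t)

/-- `γ` is a piecewise `C¹` curve on `[0,1]`: there is a subdivision `0 = t₀ ≤ t₁ ≤ ⋯ ≤ tₙ = 1`
such that `γ` is `C¹` on each closed interval `[tᵢ, tᵢ₊₁]` (hence it is continuous on `[0,1]`).
Curves are given by functions on `ℝ` whose values outside of `[0,1]` are irrelevant. -/
def IsPiecewiseC1Curve (E : Type*) [NormedAddCommGroup E] [NormedSpace ℝ E]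
    {X : Type*} [TopologicalSpace X] [ChartedSpace E X] (γ : ℝ → X) : Prop :=
  ∃ (n : ℕ) (t : ℕ → ℝ), Monotone t ∧ t 0 = 0 ∧ t n = 1 ∧
    ∀ i < n, ContMDiffOn 𝓘(ℝ, ℝ) 𝓘(ℝ, E) 1 γ (Icc (t i) (t (i + 1)))

/-- The set `C^φ(X)` of piecewise `C¹` curves `γ` on `[0,1]` with `γ(1) = φ γ(0)`. -/
def twistedLoops (E : Type*) [NormedAddCommGroup E] [NormedSpace ℝ E]
    (X : Type*) [TopologicalSpace X] [ChartedSpace E X]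
    {G : Type*} [SMul G X] (φ : G) : Set (ℝ → X) :=
  {γ | IsPiecewiseC1Curve E γ ∧ γ 1 = φ • γ 0}

end Forms

section Bundles

variable (EM : Type*) [NormedAddCommGroup EM] [NormedSpace ℝ EM]
  {M : Type*} [TopologicalSpace M] [ChartedSpace EM M]
  (EP : Type*) [NormedAddCommGroup EP] [NormedSpace ℝ EP]
  {P : Type*} [TopologicalSpace P] [ChartedSpace EP P] [MulAction Circle P]

/-- `p : P → M` is a smooth principal `U(1)`-bundle. As `U(1)` is commutative, its action on the
right `y · z` is written `z • y`. -/
structure IsPrincipalCircleBundle (p : P → M) : Prop where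
  smooth_smul : ContMDiffSMul (𝓡 1) 𝓘(ℝ, EP) ∞ Circle P
  smooth_proj : ContMDiff 𝓘(ℝ, EP) 𝓘(ℝ, EM) ∞ p
  proj_smul : ∀ (z : Circle) (y : P), p (z • y) = p y
  /-- `U(1)`-equivariant local trivializations `p⁻¹(U) ≃ U × U(1)` over `U`. -/
  exists_localTriv : ∀ x : M, ∃ U : Set M, IsOpen U ∧ x ∈ U ∧
    ∃ Ψ : PartialDiffeomorph 𝓘(ℝ, EP) (𝓘(ℝ, EM).prod (𝓡 1)) P (M × Circle) ∞,
      Ψ.source = p ⁻¹' U ∧ Ψ.target = U ×ˢ (univ : Set Circle) ∧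
      (∀ y ∈ p ⁻¹' U, (Ψ y).1 = p y) ∧
      ∀ (z : Circle), ∀ y ∈ p ⁻¹' U, Ψ (z • y) = ((Ψ y).1, (Ψ y).2 * z)

/-- `p : P → M` is a `G`-equivariant `U(1)`-bundle: the Lie group `G` acts smoothly on the
principal bundle `P` by principal bundle automorphisms that cover the given action on `M`. -/
structure IsEquivariantCircleBundle
    (EG : Type*) [NormedAddCommGroup EG] [NormedSpace ℝ EG]
    (G : Type*) [TopologicalSpace G] [ChartedSpace EG G] [Group G]
    [MulAction G M] [MulAction G P] (p : P → M) : Prop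
    extends IsPrincipalCircleBundle EM EP p where
  smooth_group_smul : ContMDiffSMul 𝓘(ℝ, EG) 𝓘(ℝ, EP) ∞ G P
  proj_group_smul : ∀ (φ : G) (y : P), p (φ • y) = φ • p y
  group_smul_comm : ∀ (φ : G) (z : Circle) (y : P), φ • z • y = z • φ • y

variable {EP} in
/-- `Ξ ∈ Ω¹(P, iℝ)` is a connection form: it is smooth with imaginary values, it is
`U(1)`-invariant, and it takes the value `i` on the fundamental vector field
`d/dt|₀ (y · exp(it))`. -/
structure IsCircleConnection [IsManifold 𝓘(ℝ, EP) ∞ P] (Ξ : OneForm EP P ℂ) : Prop where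
  smooth : Ξ.IsSmooth
  imaginary : ∀ (y : P) (v : TangentSpace 𝓘(ℝ, EP) y), (Ξ y v).re = 0
  invariant : Ξ.IsInvariant Circle
  fundamental : ∀ y : P,
    Ξ (Circle.exp 0 • y) (curveVelocity EP (fun t : ℝ ↦ Circle.exp t • y) 0) = Complex.I

variable {EP} in
/-- `γ'` is a `Ξ`-horizontal lift of the curve `γ : [0,1] → M` starting at `y`. -/
structure IsHorizontalLift (p : P → M) (Ξ : OneForm EP P ℂ) (γ : ℝ → M) (y : P)
    (γ' : ℝ → P) : Prop where
  piecewiseC1 : IsPiecewiseC1Curve EP γ'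
  proj : ∀ t ∈ Icc (0 : ℝ) 1, p (γ' t) = γ t
  start : γ' 0 = y
  horizontal : ∀ t ∈ Ioo (0 : ℝ) 1, MDifferentiableAt 𝓘(ℝ, ℝ) 𝓘(ℝ, EP) γ' t →
    Ξ (γ' t) (curveVelocity EP γ' t) = 0

variable {EP} in
/-- The characteristic property of the `φ`-equivariant holonomy `u` of `γ`: for every `y` over
`γ(0)`, the horizontal lift of `γ` starting at `y` ends at `φ_P(y) · u`. -/
def IsEquivariantHolonomy {G : Type*} [SMul G P] (p : P → M) (Ξ : OneForm EP P ℂ) (φ : G)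
    (γ : ℝ → M) (u : Circle) : Prop :=
  ∀ y : P, p y = γ 0 → ∃ γ' : ℝ → P, IsHorizontalLift p Ξ γ y γ' ∧ γ' 1 = u • φ • y

variable {EP} in
/-- The `φ`-equivariant holonomy `Hol_φ^Ξ(γ)` of `γ ∈ C^φ(M)`: the element of `U(1)` with the
characteristic property above. For an invariant connection it exists and is unique, because
horizontal lifts exist and are unique, and `G` and `U(1)` map horizontal lifts to horizontal
lifts. -/
noncomputable def equivariantHolonomy {G : Type*} [SMul G P] (p : P → M) (Ξ : OneForm EP P ℂ)
    (φ : G) (γ : ℝ → M) : Circle :=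
  Classical.epsilon (IsEquivariantHolonomy p Ξ φ γ)

/-- `P → M` is trivial as a `G`-equivariant `U(1)`-bundle: there is an isomorphism
`M × U(1) ≃ P` of `U(1)`-bundles over `M`, equivariant for the action
`φ (x, u) = (φ x, u)` of `G` on `M × U(1)`. -/
def IsTrivialEquivariantCircleBundle (G : Type*) [SMul G M] [SMul G P] (p : P → M) : Prop :=
  ∃ Φ : Diffeomorph (𝓘(ℝ, EM).prod (𝓡 1)) 𝓘(ℝ, EP) (M × Circle) P ∞,
    (∀ (x : M) (u : Circle), p (Φ (x, u)) = x) ∧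
    (∀ (x : M) (u z : Circle), Φ (x, u * z) = z • Φ (x, u)) ∧
    ∀ (φ : G) (x : M) (u : Circle), Φ (φ • x, u) = φ • Φ (x, u)

end Bundles

/-! An equivariant trivialization amounts to a `G`-equivariant global section `s`, so the task is to
pass between such sections and invariant forms.

Given `s`, put `β = -(2π)⁻¹ Im s^*Ξ`, which inherits invariance from `s` and `Ξ`. Rotating `s ∘ γ`
by `exp(-i ∫ Im Ξ)` makes it horizontal (`reflTransGen_isHorizontalPiece_exp_smul`). Since `s (γ 1)
= φ • s (γ 0)`, the end of this lift displays the holonomy as `exp(2πi ∫ β)`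
(`equivariantHolonomy_eq_of_section`). One lift is enough, because lifts are unique
(`IsHorizontalLift.unique`) and `U(1)` permutes them.

Given `β`, twist the connection to `Ξ + 2πi p^*β`. Its parallel transport is a `Ξ`-horizontal lift
corrected by `exp(-2πi ∫ β)`, so the holonomy formula says that transport from `y` to the fibre over
`φ • p y` ends at `φ • y` (`eq_smul_of_reflTransGen_transportStep`). For `φ = 1` this is path
independence, so on the connected base transport from one point defines a section; for general `φ`
it makes that section equivariant. Smoothness is local: relative to a smooth local section the new
one has a circle coordinate `z` with `dz = -i z A` for a smooth `A`, and bootstrapping applies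
(`contDiffOn_of_transport`). -/

/-! ### Smooth 1-forms: evaluation, pullback, one-sided velocities. -/

section FormCalculus

variable {E : Type*} [NormedAddCommGroup E] [NormedSpace ℝ E]
  {X : Type*} [TopologicalSpace X] [ChartedSpace E X] [IsManifold 𝓘(ℝ, E) ∞ X]
  {E' : Type*} [NormedAddCommGroup E'] [NormedSpace ℝ E']
  {Y : Type*} [TopologicalSpace Y] [ChartedSpace E' Y]
  {F : Type*} [NormedAddCommGroup F] [NormedSpace ℝ F]

/-- Evaluating a smooth 1-form on a `C^n` family of tangent vectors gives a `C^n` function. -/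
theorem OneForm.IsSmooth.contMDiffWithinAt_apply {η : OneForm E X F} (hη : η.IsSmooth)
    {n : ℕ∞} {v : Y → TangentBundle 𝓘(ℝ, E) X} {s : Set Y} {y : Y}
    (hv : ContMDiffWithinAt 𝓘(ℝ, E') 𝓘(ℝ, E).tangent n v s y) :
    ContMDiffWithinAt 𝓘(ℝ, E') 𝓘(ℝ, F) n (fun y ↦ η (v y).1 (v y).2) s y := by
  have h1 : ContMDiffWithinAt 𝓘(ℝ, E') 𝓘(ℝ, E) n (fun y ↦ (v y).1) s y :=
    (contMDiffWithinAt_totalSpace.1 hv).1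
  have h2 := ((hη.of_le (by exact_mod_cast le_top)).contMDiffAt
    (x := (v y).1)).comp_contMDiffWithinAt y h1
  have h3 := ContMDiffWithinAt.clm_bundle_apply (E₂ := Bundle.Trivial X F) (IB := 𝓘(ℝ, E)) h2
    (v := fun y ↦ (v y).2) hv
  exact (contMDiffWithinAt_totalSpace.1 h3).2

/-- The pullback of a 1-form by a map. -/
noncomputable def OneForm.pullback (η : OneForm E X F) (f : Y → X) : OneForm E' Y F :=
  fun y ↦ (η (f y)).comp (mfderiv 𝓘(ℝ, E') 𝓘(ℝ, E) f y)

/-- In the trivializations at `y₀` and `f y₀` the pullback is the composite of the coordinate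
expressions of `η` and of the derivative of `f`, and both are smooth. -/
theorem OneForm.IsSmooth.contMDiffAt_pullback [IsManifold 𝓘(ℝ, E') ∞ Y]
    {η : OneForm E X F} (hη : η.IsSmooth) {f : Y → X} {y₀ : Y}
    (hf : ContMDiffAt 𝓘(ℝ, E') 𝓘(ℝ, E) ∞ f y₀) :
    ContMDiffAt 𝓘(ℝ, E') (𝓘(ℝ, E').prod 𝓘(ℝ, E' →L[ℝ] F)) ∞
    (fun y ↦ TotalSpace.mk' (E' →L[ℝ] F)
      (E := fun y : Y ↦ TangentSpace 𝓘(ℝ, E') y →L[ℝ] F) y (η.pullback (E' := E') f y)) y₀ := by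
  refine (contMDiffAt_hom_bundle (E₂ := Bundle.Trivial Y F) _).2 ⟨contMDiffAt_id, ?_⟩
  have h1 := ((contMDiffAt_hom_bundle (E₂ := Bundle.Trivial X F) _).1
    ((hη (f y₀)).comp y₀ hf)).2
  have h2 := hf.mfderiv_const (m := ∞) (by simp)
  refine (h1.clm_comp h2).congr_of_eventuallyEq ?_
  have A : ∀ᶠ y in 𝓝 y₀, y ∈ (trivializationAt E' (TangentSpace 𝓘(ℝ, E')) y₀).baseSet :=
    (trivializationAt E' (TangentSpace 𝓘(ℝ, E')) y₀).open_baseSet.mem_nhds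
      (FiberBundle.mem_baseSet_trivializationAt' y₀)
  have B : ∀ᶠ y in 𝓝 y₀, f y ∈ (trivializationAt E (TangentSpace 𝓘(ℝ, E)) (f y₀)).baseSet :=
    hf.continuousAt.eventually
    ((trivializationAt E (TangentSpace 𝓘(ℝ, E)) (f y₀)).open_baseSet.mem_nhds
      (FiberBundle.mem_baseSet_trivializationAt' (f y₀)))
  filter_upwards [A, B] with y hA hB
  simp only [OneForm.pullback, inTangentCoordinates, Function.comp, id]
  rw [ContinuousLinearMap.inCoordinates_eq hA (by trivial),
    ContinuousLinearMap.inCoordinates_eq hB (by trivial),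
    ContinuousLinearMap.inCoordinates_eq hA hB]
  ext w
  simp [Trivialization.symm_apply_apply_mk _ hB]

theorem OneForm.IsSmooth.pullback [IsManifold 𝓘(ℝ, E') ∞ Y]
    {η : OneForm E X F} (hη : η.IsSmooth) {f : Y → X}
    (hf : ContMDiff 𝓘(ℝ, E') 𝓘(ℝ, E) ∞ f) : (η.pullback (E' := E') f).IsSmooth :=
  fun y ↦ hη.contMDiffAt_pullback (hf y)

/-- In a vector space, a smooth 1-form is a smooth function to the dual space. -/
theorem OneForm.IsSmooth.contDiffAt_pullback
    {η : OneForm E X F} (hη : η.IsSmooth) {f : E' → X} {y₀ : E'}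
    (hf : ContMDiffAt 𝓘(ℝ, E') 𝓘(ℝ, E) ∞ f y₀) :
    ContDiffAt ℝ ∞ (F := E' →L[ℝ] F) (η.pullback (E' := E') f) y₀ := by
  have := ((contMDiffAt_hom_bundle (E₂ := Bundle.Trivial E' F) _).1 (hη.contMDiffAt_pullback hf)).2
  rw [contMDiffAt_iff_contDiffAt] at this
  refine this.congr_of_eventuallyEq (Filter.Eventually.of_forall fun y ↦ ?_)
  refine ContinuousLinearMap.ext fun w ↦ ?_
  simp only [ContinuousLinearMap.inCoordinates, TangentBundle.symmL_model_space]
  change _ = Trivialization.continuousLinearMapAt ℝ (trivializationAt F (Bundle.Trivial E' F) y₀) y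
    (η.pullback f y w)
  rw [Trivialization.continuousLinearMapAt_apply,
    Trivialization.coe_linearMapAt_of_mem _ (by trivial)]
  rfl

/-- Postcomposition of a smooth form with a linear map of the values. -/
theorem OneForm.IsSmooth.clm_comp {F' : Type*} [NormedAddCommGroup F'] [NormedSpace ℝ F']
    {η : OneForm E X F} (hη : η.IsSmooth) (L : F →L[ℝ] F') :
    OneForm.IsSmooth (fun x ↦ L.comp (η x) : OneForm E X F') := by
  intro x
  refine (contMDiffAt_hom_bundle (E₂ := Bundle.Trivial X F') _).2 ⟨contMDiffAt_id, ?_⟩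
  have h1 := ((contMDiffAt_hom_bundle (E₂ := Bundle.Trivial X F) _).1 (hη x)).2
  refine ((contMDiffAt_const (c := L)).clm_comp h1).congr_of_eventuallyEq ?_
  have A : ∀ᶠ y in 𝓝 x, y ∈ (trivializationAt E (TangentSpace 𝓘(ℝ, E)) x).baseSet :=
    (trivializationAt E (TangentSpace 𝓘(ℝ, E)) x).open_baseSet.mem_nhds
      (FiberBundle.mem_baseSet_trivializationAt' x)
  filter_upwards [A] with y hA
  rw [ContinuousLinearMap.inCoordinates_eq hA (by trivial),
    ContinuousLinearMap.inCoordinates_eq hA (by trivial)]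
  ext w
  simp

/-- The values of a smooth 1-form on the one-sided velocities of a `C¹` curve are continuous. -/
theorem OneForm.IsSmooth.continuousOn_velocityWithin {η : OneForm E X F} (hη : η.IsSmooth)
    {γ : ℝ → X} {a b : ℝ} (hab : a < b)
    (hγ : ContMDiffOn 𝓘(ℝ, ℝ) 𝓘(ℝ, E) 1 γ (Icc a b)) :
    ContinuousOn (fun t ↦ η (γ t) (mfderivWithin 𝓘(ℝ, ℝ) 𝓘(ℝ, E) γ (Icc a b) t (1 : ℝ)))
      (Icc a b) := by
  have hu : UniqueMDiffOn 𝓘(ℝ, ℝ) (Icc a b) := (uniqueDiffOn_Icc hab).uniqueMDiffOn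
  have h1 := hγ.continuousOn_tangentMapWithin le_rfl hu
  have h2 : Continuous (fun t : ℝ ↦ (⟨t, (1 : ℝ)⟩ : TangentBundle 𝓘(ℝ, ℝ) ℝ)) :=
    (tangentBundleModelSpaceHomeomorph 𝓘(ℝ, ℝ)).symm.continuous.comp (Continuous.prodMk_left (1 : ℝ))
  have h3 : ContinuousOn (fun t : ℝ ↦ tangentMapWithin 𝓘(ℝ, ℝ) 𝓘(ℝ, E) γ (Icc a b) ⟨t, (1 : ℝ)⟩)
      (Icc a b) := h1.comp h2.continuousOn (fun t ht ↦ ht)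
  intro t ht
  have h4 := hη.contMDiffWithinAt_apply (E' := ℝ) (n := 0)
    (contMDiffOn_zero_iff.2 h3 t ht)
  exact h4.continuousWithinAt

omit [IsManifold 𝓘(ℝ, E) ∞ X] in
theorem mfderivWithin_Icc_apply_eq_curveVelocity {γ : ℝ → X} {a b t : ℝ}
    (hab : a < b) (ht : t ∈ Icc a b)
    (hγ : MDifferentiableAt 𝓘(ℝ, ℝ) 𝓘(ℝ, E) γ t) :
    mfderivWithin 𝓘(ℝ, ℝ) 𝓘(ℝ, E) γ (Icc a b) t (1 : ℝ) = curveVelocity E γ t := by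
  rw [curveVelocity, mfderivWithin_eq_mfderiv ((uniqueDiffOn_Icc hab).uniqueMDiffOn t ht) hγ]

end FormCalculus

/-! ### Smoothness of circle-valued maps. -/

section CircleValued

/-- A circle-valued function in terms of its angle relative to a base point. -/
theorem Circle.eq_mul_exp_arg_div (z w : Circle) :
    z = w * Circle.exp (Complex.arg ((z : ℂ) / w)) := by
  rw [← Circle.coe_div, Circle.exp_arg, mul_div_cancel]

theorem contDiffAt_arg_div_self (w : Circle) :
    ContDiffAt ℝ ∞ (fun z : ℂ ↦ Complex.arg (z / w)) w := by
  have h : (fun z : ℂ ↦ Complex.arg (z / w)) = fun z ↦ Complex.imCLM (Complex.log (z / w)) := by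
    ext z; simp [Complex.log_im]
  rw [h]
  have h1 : ContDiffAt ℝ ∞ Complex.log ((w : ℂ) / w) := by
    rw [div_self w.coe_ne_zero]
    exact (Complex.contDiffAt_log (n := ∞) Complex.one_mem_slitPlane).restrict_scalars ℝ
  exact Complex.imCLM.contDiff.contDiffAt.comp _
    (h1.comp (w : ℂ) (f := fun z : ℂ ↦ z / w) (contDiffAt_id.div_const _))

/-- Write `f = f x * Circle.exp (arg (f / f x))`. The quotient is `1` at `x`, `arg` is smooth near
`1`, and `Circle.exp` is smooth. -/
theorem contMDiffAt_circle_of_coe {E : Type*} [NormedAddCommGroup E] [NormedSpace ℝ E]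
    {X : Type*} [TopologicalSpace X] [ChartedSpace E X] {f : X → Circle} {x : X}
    (hf : ContMDiffAt 𝓘(ℝ, E) 𝓘(ℝ, ℂ) ∞ (fun y ↦ (f y : ℂ)) x) :
    ContMDiffAt 𝓘(ℝ, E) (𝓡 1) ∞ f x := by
  have h1 := (contMDiff_circleExp (m := ∞)).contMDiffAt.comp x
    ((contDiffAt_arg_div_self (f x)).contMDiffAt.comp x hf)
  exact ((contMDiff_mul_left (I := 𝓡 1) (n := ∞) (a := f x)).contMDiffAt.comp x
    h1).congr_of_eventuallyEq
    (Filter.Eventually.of_forall fun y ↦ Circle.eq_mul_exp_arg_div (f y) (f x))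

theorem Circle.contMDiff_coe {n : ℕ∞} : ContMDiff (𝓡 1) 𝓘(ℝ, ℂ) n (fun z : Circle ↦ (z : ℂ)) :=
  haveI : Fact (Module.finrank ℝ ℂ = 1 + 1) := Complex.finrank_real_complex_fact
  contMDiff_coe_sphere (E := ℂ) (n := 1)

end CircleValued

/-! ### The connection form on curves moved along the fibres. -/

section Leibniz

variable {EP : Type*} [NormedAddCommGroup EP] [NormedSpace ℝ EP]
  {P : Type*} [TopologicalSpace P] [ChartedSpace EP P] [IsManifold 𝓘(ℝ, EP) ∞ P]
  [MulAction Circle P] {Ξ : OneForm EP P ℂ}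

omit [IsManifold 𝓘(ℝ, EP) ∞ P] in
theorem contMDiff_exp_smul (hsm : ContMDiffSMul (𝓡 1) 𝓘(ℝ, EP) ∞ Circle P) :
    ContMDiff (𝓘(ℝ, ℝ).prod 𝓘(ℝ, EP)) 𝓘(ℝ, EP) ∞ (fun q : ℝ × P ↦ Circle.exp q.1 • q.2) :=
  hsm.contMDiff_smul.comp
    ((contMDiff_circleExp.comp contMDiff_fst).prodMk contMDiff_snd)

/-- The connection axiom concerns parameter `0` only; the group law `exp r • exp s • y` shifts it to
every `s`. -/
theorem IsCircleConnection.apply_mfderiv_exp_smul (hΞ : IsCircleConnection Ξ)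
    (hsm : ContMDiffSMul (𝓡 1) 𝓘(ℝ, EP) ∞ Circle P) (y : P) (s : ℝ) :
    Ξ (Circle.exp s • y) (mfderiv 𝓘(ℝ, ℝ) 𝓘(ℝ, EP) (fun s : ℝ ↦ Circle.exp s • y) s (1 : ℝ)) =
      Complex.I := by
  let g : ℝ → P := fun r ↦ Circle.exp r • (Circle.exp s • y)
  have hg : ContMDiff 𝓘(ℝ, ℝ) 𝓘(ℝ, EP) ∞ g :=
    (contMDiff_exp_smul hsm).comp (contMDiff_id.prodMk contMDiff_const)
  have h0 := hΞ.fundamental (Circle.exp s • y)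
  have hfg : (fun r : ℝ ↦ Circle.exp r • y) = g ∘ (fun r ↦ r - s) := by
    ext r
    simp only [g, Function.comp, smul_smul, ← Circle.exp_add, sub_add_cancel]
  have hd : HasMFDerivAt 𝓘(ℝ, ℝ) 𝓘(ℝ, ℝ) (fun r : ℝ ↦ r - s) s (ContinuousLinearMap.id ℝ ℝ) :=
    ((hasFDerivAt_id s).sub_const s).hasMFDerivAt
  have hgd : HasMFDerivAt 𝓘(ℝ, ℝ) 𝓘(ℝ, EP) g (s - s) (mfderiv 𝓘(ℝ, ℝ) 𝓘(ℝ, EP) g (s - s)) :=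
    (hg.mdifferentiableAt (by simp)).hasMFDerivAt
  have hc := (HasMFDerivAt.comp (f := fun r ↦ r - s) s hgd hd).mfderiv
  -- Curve, base point and parameter are generalized together, because the type of the derivative
  -- depends on them.
  have key : ∀ (f : ℝ → P) (z : P) (r : ℝ), f = g ∘ (fun r ↦ r - s) → z = g r → s - s = r →
      Ξ z (mfderiv 𝓘(ℝ, ℝ) 𝓘(ℝ, EP) f s (1 : ℝ)) =
        Ξ (g r) (mfderiv 𝓘(ℝ, ℝ) 𝓘(ℝ, EP) g r (1 : ℝ)) := by
    rintro _ _ _ rfl rfl rfl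
    rw [hc]
    rfl
  rw [key _ _ 0 hfg (by simp [g]) (sub_self s)]
  exact h0

/-- By the Leibniz rule the velocity is `θ'` times the fundamental vector plus the translated
velocity of `c`; the connection axiom evaluates the first term and invariance the second. -/
theorem IsCircleConnection.apply_velocity_exp_smul (hΞ : IsCircleConnection Ξ)
    (hsm : ContMDiffSMul (𝓡 1) 𝓘(ℝ, EP) ∞ Circle P) {c : ℝ → P} {θ : ℝ → ℝ} {θ' t : ℝ}
    (hc : MDifferentiableAt 𝓘(ℝ, ℝ) 𝓘(ℝ, EP) c t) (hθ : HasDerivAt θ θ' t) :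
    Ξ (Circle.exp (θ t) • c t) (curveVelocity EP (fun t ↦ Circle.exp (θ t) • c t) t) =
      θ' * Complex.I + Ξ (c t) (curveVelocity EP c t) := by
  have hF := (contMDiff_exp_smul hsm).mdifferentiableAt (by simp) (x := (θ t, c t))
  have hpair := hθ.hasFDerivAt.hasMFDerivAt.prodMk hc.hasMFDerivAt
  have h1 := (hF.hasMFDerivAt.comp t hpair).mfderiv
  have h2 : curveVelocity EP (fun t ↦ Circle.exp (θ t) • c t) t =
      (mfderiv 𝓘(ℝ, ℝ) 𝓘(ℝ, EP) (fun s : ℝ ↦ Circle.exp s • c t) (θ t) θ' :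
        TangentSpace 𝓘(ℝ, EP) (Circle.exp (θ t) • c t)) +
      mfderiv 𝓘(ℝ, EP) 𝓘(ℝ, EP) (fun y : P ↦ Circle.exp (θ t) • y) (c t)
        (curveVelocity EP c t) := by
    let v : EP := curveVelocity EP c t
    have h3 := mfderiv_prod_eq_add_apply hF (v := ((θ', v) : ℝ × EP))
    refine Eq.trans ?_ h3
    refine (congrArg (fun L : ℝ →L[ℝ] EP ↦ L (1 : ℝ)) h1).trans ?_
    change mfderiv _ _ _ _ (ContinuousLinearMap.toSpanSingleton ℝ θ' (1 : ℝ), _) = _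
    rw [ContinuousLinearMap.toSpanSingleton_apply, one_smul]
    rfl
  rw [h2, map_add]
  congr 1
  · have := hΞ.apply_mfderiv_exp_smul hsm (c t) (θ t)
    let L : ℝ →L[ℝ] ℂ := (Ξ (Circle.exp (θ t) • c t)).comp
      (mfderiv 𝓘(ℝ, ℝ) 𝓘(ℝ, EP) (fun s : ℝ ↦ Circle.exp s • c t) (θ t))
    have h4 : L θ' = θ' • L 1 := by rw [← map_smul, smul_eq_mul, mul_one]
    exact h4.trans ((congrArg (θ' • ·) this).trans (by simp))
  · exact hΞ.invariant _ _ _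

theorem IsCircleConnection.apply_velocity_const_smul (hΞ : IsCircleConnection Ξ)
    (hsm : ContMDiffSMul (𝓡 1) 𝓘(ℝ, EP) ∞ Circle P) {c : ℝ → P} {t : ℝ} (w : Circle)
    (hc : MDifferentiableAt 𝓘(ℝ, ℝ) 𝓘(ℝ, EP) c t) :
    Ξ (w • c t) (curveVelocity EP (fun t ↦ w • c t) t) = Ξ (c t) (curveVelocity EP c t) := by
  have := hΞ.apply_velocity_exp_smul hsm hc (hasDerivAt_const t (Complex.arg w))
  rw [Circle.exp_arg] at this
  simpa using this

end Leibniz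

/-! ### Velocities under local change, affine reparametrization and composition. -/

section Velocity

variable {E : Type*} [NormedAddCommGroup E] [NormedSpace ℝ E]
  {X : Type*} [TopologicalSpace X] [ChartedSpace E X]
  {F : Type*} [NormedAddCommGroup F] [NormedSpace ℝ F]

theorem OneForm.apply_velocity_congr (η : OneForm E X F) {c c' : ℝ → X} {t : ℝ}
    (h : c =ᶠ[𝓝 t] c') :
    η (c t) (curveVelocity E c t) = η (c' t) (curveVelocity E c' t) :=
  congrArg₂ (fun (y : X) (v : E) ↦ (η y : E →L[ℝ] F) v) h.eq_of_nhds
    (congrArg (fun L : ℝ →L[ℝ] E ↦ L (1 : ℝ)) h.mfderiv_eq)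

theorem curveVelocity_of_not_mdifferentiableAt {c : ℝ → X} {t : ℝ}
    (h : ¬ MDifferentiableAt 𝓘(ℝ, ℝ) 𝓘(ℝ, E) c t) : curveVelocity E c t = 0 := by
  rw [curveVelocity, mfderiv_zero_of_not_mdifferentiableAt h]
  rfl

theorem hasMFDerivAt_affine (k l t : ℝ) :
    HasMFDerivAt 𝓘(ℝ, ℝ) 𝓘(ℝ, ℝ) (fun t : ℝ ↦ k * t + l) t
      (ContinuousLinearMap.toSpanSingleton ℝ k) := by
  have := ((hasDerivAt_id t).const_mul k).add_const l
  rw [mul_one] at this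
  exact this.hasFDerivAt.hasMFDerivAt

theorem mdifferentiableAt_comp_affine_iff {c : ℝ → X} {k l t : ℝ} (hk : k ≠ 0) :
    MDifferentiableAt 𝓘(ℝ, ℝ) 𝓘(ℝ, E) (fun t ↦ c (k * t + l)) t ↔
      MDifferentiableAt 𝓘(ℝ, ℝ) 𝓘(ℝ, E) c (k * t + l) := by
  constructor
  · intro h
    have e : k⁻¹ * (k * t + l) + -(k⁻¹ * l) = t := by field_simp; ring
    have h' := MDifferentiableAt.comp (f := fun s : ℝ ↦ k⁻¹ * s + -(k⁻¹ * l))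
      (g := fun t ↦ c (k * t + l)) (k * t + l) (by rw [e]; exact h)
      (hasMFDerivAt_affine k⁻¹ (-(k⁻¹ * l)) (k * t + l)).mdifferentiableAt
    refine h'.congr_of_eventuallyEq (Filter.Eventually.of_forall fun s ↦ ?_)
    simp only [Function.comp]
    congr 1
    field_simp
    ring
  · intro h
    exact MDifferentiableAt.comp (f := fun t : ℝ ↦ k * t + l) t h
      (hasMFDerivAt_affine k l t).mdifferentiableAt

theorem curveVelocity_comp_affine {c : ℝ → X} {k l t : ℝ} (hk : k ≠ 0) :
    curveVelocity E (fun t ↦ c (k * t + l)) t = k • curveVelocity E c (k * t + l) := by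
  by_cases h : MDifferentiableAt 𝓘(ℝ, ℝ) 𝓘(ℝ, E) c (k * t + l)
  · have h1 := (HasMFDerivAt.comp (f := fun t : ℝ ↦ k * t + l) t h.hasMFDerivAt
      (hasMFDerivAt_affine k l t)).mfderiv
    let L : ℝ →L[ℝ] E := mfderiv 𝓘(ℝ, ℝ) 𝓘(ℝ, E) c (k * t + l)
    have h2 : L (ContinuousLinearMap.toSpanSingleton ℝ k (1 : ℝ)) = k • L (1 : ℝ) := by
      rw [← map_smul]; simp
    exact (congrArg (fun L : ℝ →L[ℝ] E ↦ L (1 : ℝ)) h1).trans h2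
  · rw [curveVelocity_of_not_mdifferentiableAt h, smul_zero,
      curveVelocity_of_not_mdifferentiableAt (mt (mdifferentiableAt_comp_affine_iff hk).1 h)]

variable {E' : Type*} [NormedAddCommGroup E'] [NormedSpace ℝ E']
  {Y : Type*} [TopologicalSpace Y] [ChartedSpace E' Y]

theorem curveVelocity_comp {f : X → Y} {c : ℝ → X} {t : ℝ}
    (hf : MDifferentiableAt 𝓘(ℝ, E) 𝓘(ℝ, E') f (c t))
    (hc : MDifferentiableAt 𝓘(ℝ, ℝ) 𝓘(ℝ, E) c t) :
    curveVelocity E' (f ∘ c) t = mfderiv 𝓘(ℝ, E) 𝓘(ℝ, E') f (c t) (curveVelocity E c t) :=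
  congrArg (fun L : ℝ →L[ℝ] E' ↦ L (1 : ℝ)) (mfderiv_comp t hf hc)

end Velocity

/-! ### Piecewise `C¹` curves as chains of `C¹` pieces. -/

section Subdivision

open Relation

/-- `b` follows `a` and the curve `γ` is `C¹` on `[a, b]`. -/
def IsC1Piece (E : Type*) [NormedAddCommGroup E] [NormedSpace ℝ E]
    {X : Type*} [TopologicalSpace X] [ChartedSpace E X] (γ : ℝ → X) (a b : ℝ) : Prop :=
  a < b ∧ ContMDiffOn 𝓘(ℝ, ℝ) 𝓘(ℝ, E) 1 γ (Icc a b)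

theorem reflTransGen_le {R : ℝ → ℝ → Prop} (hR : ∀ a b, R a b → a < b) {a b : ℝ}
    (h : ReflTransGen R a b) : a ≤ b := by
  induction h with
  | refl => exact le_rfl
  | tail _ h ih => exact ih.trans (hR _ _ h).le

theorem exists_piece_mem_Ico {R : ℝ → ℝ → Prop} {a b : ℝ}
    (h : ReflTransGen R a b) {t : ℝ} (ht : t ∈ Ico a b) : ∃ c d, R c d ∧ t ∈ Ico c d := by
  induction h with
  | refl => exact absurd ht (by simp)
  | @tail b c _ h ih =>
    rcases lt_or_ge t b with h1 | h1
    · exact ih ⟨ht.1, h1⟩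
    · exact ⟨b, c, h, h1, ht.2⟩

/-- `S` collects the breakpoints; its finiteness lets derivative arguments ignore them. -/
theorem exists_finite_forall_piece_mem_Ioo {R : ℝ → ℝ → Prop} {a b : ℝ}
    (h : ReflTransGen R a b) :
    ∃ S : Set ℝ, S.Finite ∧ ∀ t ∈ Ioo a b \ S, ∃ c d, R c d ∧ t ∈ Ioo c d := by
  induction h with
  | refl => exact ⟨∅, finite_empty, by simp⟩
  | @tail b c _ h ih =>
    obtain ⟨S, hS, hS'⟩ := ih
    refine ⟨insert b S, hS.insert b, fun t ht ↦ ?_⟩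
    rw [mem_sdiff, mem_insert_iff, not_or] at ht
    rcases lt_or_ge t b with h1 | h1
    · exact hS' t ⟨⟨ht.1.1, h1⟩, ht.2.2⟩
    · exact ⟨b, c, h, lt_of_le_of_ne h1 (Ne.symm ht.2.1), ht.1.2⟩

theorem reflTransGen_congr {R R' : ℝ → ℝ → Prop} (hR : ∀ a b, R a b → a < b) {a b : ℝ}
    (h : ReflTransGen R a b) (h' : ∀ c d, a ≤ c → d ≤ b → R c d → R' c d) :
    ReflTransGen R' a b := by
  induction h with
  | refl => exact .refl
  | tail h1 h2 ih =>
    exact (ih fun c d hc hd ↦ h' c d hc (hd.trans (hR _ _ h2).le)).tail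
      (h' _ _ (reflTransGen_le hR h1) le_rfl h2)

variable {E : Type*} [NormedAddCommGroup E] [NormedSpace ℝ E]
  {X : Type*} [TopologicalSpace X] [ChartedSpace E X]
  {E' : Type*} [NormedAddCommGroup E'] [NormedSpace ℝ E']
  {Y : Type*} [TopologicalSpace Y] [ChartedSpace E' Y] {γ : ℝ → X}

/-- Chains allow induction on the last piece. Degenerate intervals of a subdivision are dropped,
since a piece has `a < b`. -/
theorem isPiecewiseC1Curve_iff :
    IsPiecewiseC1Curve E γ ↔ ReflTransGen (IsC1Piece E γ) 0 1 := by
  constructor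
  · rintro ⟨n, t, hm, h0, hn, h⟩
    have : ∀ k ≤ n, ReflTransGen (IsC1Piece E γ) (t 0) (t k) := by
      intro k
      induction k with
      | zero => exact fun _ ↦ .refl
      | succ k ih =>
        intro hk
        rcases (hm k.le_succ).eq_or_lt with h1 | h1
        · exact h1 ▸ ih (by omega)
        · exact (ih (by omega)).tail ⟨h1, h k (by omega)⟩
    simpa [h0, hn] using this n le_rfl
  · intro h
    have : ∀ a b, ReflTransGen (IsC1Piece E γ) a b → ∃ (n : ℕ) (t : ℕ → ℝ), Monotone t ∧ t 0 = a ∧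
        t n = b ∧ ∀ i < n, ContMDiffOn 𝓘(ℝ, ℝ) 𝓘(ℝ, E) 1 γ (Icc (t i) (t (i + 1))) := by
      intro a b h
      induction h with
      | refl => exact ⟨0, fun _ ↦ a, monotone_const, rfl, rfl, by simp⟩
      | @tail b c _ h2 ih =>
        obtain ⟨n, t, hm, h0, hn, h⟩ := ih
        refine ⟨n + 1, fun i ↦ if i ≤ n then t i else c, ?_, by simpa using h0, by simp, ?_⟩
        · refine monotone_nat_of_le_succ fun i ↦ ?_
          rcases lt_trichotomy i n with hi | rfl | hi
          · simpa [hi.le, Nat.succ_le_of_lt hi] using hm i.le_succ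
          · simpa [hn] using h2.1.le
          · simp [not_le.2 hi, not_le.2 (hi.trans i.lt_succ_self)]
        · intro i hi
          rcases (Nat.lt_succ_iff.1 hi).eq_or_lt with rfl | hi
          · simpa [hn] using h2.2
          · simpa [hi.le, Nat.succ_le_of_lt hi] using h i hi
    exact this 0 1 h

theorem continuousOn_of_reflTransGen {a b : ℝ} (h : ReflTransGen (IsC1Piece E γ) a b) :
    ContinuousOn γ (Icc a b) := by
  induction h with
  | refl => simp
  | @tail b c h1 h2 ih =>
    rw [← Icc_union_Icc_eq_Icc (reflTransGen_le (fun _ _ h ↦ h.1) h1) h2.1.le]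
    exact ih.union_of_isClosed h2.2.continuousOn isClosed_Icc isClosed_Icc

theorem IsC1Piece.mdifferentiableAt {a b t : ℝ} (h : IsC1Piece E γ a b) (ht : t ∈ Ioo a b) :
    MDifferentiableAt 𝓘(ℝ, ℝ) 𝓘(ℝ, E) γ t :=
  (h.2.contMDiffAt (Icc_mem_nhds ht.1 ht.2)).mdifferentiableAt one_ne_zero

theorem IsC1Piece.comp {f : X → Y} {a b : ℝ} (h : IsC1Piece E γ a b)
    (hf : ContMDiff 𝓘(ℝ, E) 𝓘(ℝ, E') 1 f) : IsC1Piece E' (f ∘ γ) a b :=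
  ⟨h.1, hf.comp_contMDiffOn h.2⟩

theorem IsC1Piece.comp_affine {a b k l : ℝ}
    (h : IsC1Piece E γ (k * a + l) (k * b + l)) (hk : 0 < k) :
    IsC1Piece E (fun t ↦ γ (k * t + l)) a b := by
  have h0 : a < b := by
    have := h.1
    rwa [add_lt_add_iff_right, mul_lt_mul_iff_right₀ hk] at this
  refine ⟨h0, h.2.comp (f := fun t : ℝ ↦ k * t + l) ?_ fun t ht ↦ ?_⟩
  · exact ((contDiff_const.mul contDiff_id).add contDiff_const).contMDiff.contMDiffOn
  · constructor
    · nlinarith [ht.1]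
    · nlinarith [ht.2]

theorem IsC1Piece.congr {a b : ℝ} {γ' : ℝ → X} (h : IsC1Piece E γ a b)
    (h' : EqOn γ' γ (Icc a b)) : IsC1Piece E γ' a b :=
  ⟨h.1, h.2.congr h'⟩

end Subdivision

/-! ### Primitives on a closed interval. -/

section Primitive

open MeasureTheory

/-- The primitive of a function that extends continuously to the closed interval. -/
theorem contDiffOn_primitive_of_eqOn_Ioo {g h H : ℝ → ℝ} {a b : ℝ} (hab : a < b)
    (hg : ContinuousOn g (Icc a b)) (hgh : EqOn h g (Ioo a b))
    (hH : ∀ t ∈ Icc a b, H t = H a + ∫ s in a..t, h s) :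
    IntervalIntegrable h volume a b ∧ ContDiffOn ℝ 1 H (Icc a b) ∧
      ∀ t ∈ Ioo a b, HasDerivAt H (h t) t := by
  -- Constant extension beyond the endpoints makes `g` continuous on `ℝ`. The values of `h` at the
  -- endpoints are uncontrolled, but they do not affect integrals.
  set g' : ℝ → ℝ := IccExtend hab.le ((Icc a b).domRestrict g) with hg'
  have hc : Continuous g' := (continuousOn_iff_continuous_domRestrict.1 hg).Icc_extend'
  have hgg : EqOn g' g (Icc a b) := fun t ht ↦ by
    simp [hg', IccExtend_of_mem, ht, Set.domRestrict_apply]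
  have hhg : EqOn h g' (Ioo a b) := fun t ht ↦ (hgh ht).trans (hgg (Ioo_subset_Icc_self ht)).symm
  have hae : ∀ t ∈ Icc a b, ∫ s in a..t, h s = ∫ s in a..t, g' s := by
    intro t ht
    refine intervalIntegral.integral_congr_ae ?_
    have : ∀ᵐ s : ℝ, s ≠ b := by simp [ae_iff, measure_singleton]
    filter_upwards [this] with s hs hst
    rw [uIoc_of_le ht.1] at hst
    exact hhg ⟨hst.1, lt_of_le_of_ne (hst.2.trans ht.2) hs⟩
  have hd : ∀ t, HasDerivAt (fun t ↦ H a + ∫ s in a..t, g' s) (g' t) t := fun t ↦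
    (intervalIntegral.integral_hasDerivAt_right (hc.intervalIntegrable _ _)
      (hc.stronglyMeasurableAtFilter _ _) hc.continuousAt).const_add _
  have hHK : EqOn H (fun t ↦ H a + ∫ s in a..t, g' s) (Icc a b) := fun t ht ↦ by
    rw [hH t ht, hae t ht]
  refine ⟨?_, ?_, fun t ht ↦ ?_⟩
  · refine (hc.intervalIntegrable a b).congr_ae ?_
    rw [uIoc_of_le hab.le, Filter.EventuallyEq, ae_restrict_iff' measurableSet_Ioc]
    have : ∀ᵐ s : ℝ, s ≠ b := by simp [ae_iff, measure_singleton]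
    filter_upwards [this] with s hs hst
    exact (hhg ⟨hst.1, lt_of_le_of_ne hst.2 hs⟩).symm
  · have hC : ContDiff ℝ 1 (fun t ↦ H a + ∫ s in a..t, g' s) := by
      rw [contDiff_one_iff_deriv]
      exact ⟨fun t ↦ (hd t).differentiableAt, by rwa [funext fun t ↦ (hd t).deriv]⟩
    exact hC.contDiffOn.congr hHK
  · rw [hhg ht]
    exact (hd t).congr_of_eventuallyEq
      (Filter.eventuallyEq_of_mem (Icc_mem_nhds ht.1 ht.2) hHK)

end Primitive

/-! ### Quotients within a fibre of a principal circle bundle. -/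

section PrincipalBundle

open Relation

variable {EM : Type*} [NormedAddCommGroup EM] [NormedSpace ℝ EM]
  {M : Type*} [TopologicalSpace M] [ChartedSpace EM M]
  {EP : Type*} [NormedAddCommGroup EP] [NormedSpace ℝ EP]
  {P : Type*} [TopologicalSpace P] [ChartedSpace EP P] [MulAction Circle P] {p : P → M}

theorem IsPrincipalCircleBundle.smul_left_cancel (hp : IsPrincipalCircleBundle EM EP p)
    {z z' : Circle} {y : P} (h : z • y = z' • y) : z = z' := by
  obtain ⟨U, -, hU, Ψ, -, -, -, hz⟩ := hp.exists_localTriv (p y)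
  have h1 := hz z y hU
  rw [h, hz z' y hU] at h1
  exact (mul_left_cancel (Prod.ext_iff.1 h1).2).symm

/-- The element `z` of the circle with `z • y = y'`, for `y` and `y'` in the same fibre. -/
noncomputable def fiberDiv (y y' : P) : Circle :=
  Classical.epsilon fun z : Circle ↦ z • y = y'

theorem IsPrincipalCircleBundle.fiberDiv_smul (hp : IsPrincipalCircleBundle EM EP p)
    {y y' : P} (h : p y = p y') : fiberDiv y y' • y = y' := by
  refine Classical.epsilon_spec (p := fun z : Circle ↦ z • y = y') ?_
  obtain ⟨U, -, hU, Ψ, hs, -, h1, hz⟩ := hp.exists_localTriv (p y)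
  refine ⟨(Ψ y).2⁻¹ * (Ψ y').2, Ψ.injOn ?_ ?_ ?_⟩
  · rw [hs, mem_preimage, hp.proj_smul]; exact hU
  · rw [hs, mem_preimage, ← h]; exact hU
  · refine (hz _ y hU).trans (Prod.ext ?_ ?_)
    · exact (h1 y hU).trans (h.trans (h1 y' (by rw [mem_preimage, ← h]; exact hU)).symm)
    · exact mul_inv_cancel_left _ _

theorem IsPrincipalCircleBundle.fiberDiv_smul_self (hp : IsPrincipalCircleBundle EM EP p)
    (z : Circle) (y : P) : fiberDiv y (z • y) = z :=
  hp.smul_left_cancel (hp.fiberDiv_smul (hp.proj_smul z y).symm)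

/-- In a local trivialization the quotient is `(Ψ y).2⁻¹ * (Ψ y').2`. -/
theorem IsPrincipalCircleBundle.contMDiffWithinAt_fiberDiv (hp : IsPrincipalCircleBundle EM EP p)
    {E : Type*} [NormedAddCommGroup E] [NormedSpace ℝ E]
    {X : Type*} [TopologicalSpace X] [ChartedSpace E X] {f g : X → P} {s : Set X} {x : X}
    {n : ℕ∞} (hx : x ∈ s) (hf : ContMDiffWithinAt 𝓘(ℝ, E) 𝓘(ℝ, EP) n f s x)
    (hg : ContMDiffWithinAt 𝓘(ℝ, E) 𝓘(ℝ, EP) n g s x) (h : ∀ x ∈ s, p (f x) = p (g x)) :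
    ContMDiffWithinAt 𝓘(ℝ, E) (𝓡 1) n (fun x ↦ fiberDiv (f x) (g x)) s x := by
  obtain ⟨U, hUo, hU, Ψ, hs, -, h1, hz⟩ := hp.exists_localTriv (p (f x))
  have hΨ : ∀ y ∈ p ⁻¹' U, ContMDiffAt 𝓘(ℝ, EP) (𝓡 1) n (fun y ↦ (Ψ y).2) y := fun y hy ↦
    contMDiffAt_snd.comp y (((Ψ.contMDiffOn_toFun y (hs ▸ hy)).contMDiffAt
      (Ψ.open_source.mem_nhds (hs ▸ hy))).of_le (by exact_mod_cast le_top))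
  have hfx : f x ∈ p ⁻¹' U := hU
  have hgx : g x ∈ p ⁻¹' U := by rw [mem_preimage, ← h x hx]; exact hU
  have h2 := (hΨ _ hfx).comp_contMDiffWithinAt x hf
  have h3 := (hΨ _ hgx).comp_contMDiffWithinAt x hg
  have hkey : ∀ y y', p y = p y' → y ∈ p ⁻¹' U → fiberDiv y y' = (Ψ y).2⁻¹ * (Ψ y').2 := by
    intro y y' hyy hy
    have h4 := hz (fiberDiv y y') y hy
    rw [hp.fiberDiv_smul hyy] at h4
    rw [h4, inv_mul_cancel_left]
  have hfU : ∀ᶠ x' in 𝓝[s] x, f x' ∈ p ⁻¹' U :=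
    hf.continuousWithinAt.eventually ((hUo.preimage hp.smooth_proj.continuous).mem_nhds hU)
  refine (h2.inv.mul h3).congr_of_eventuallyEq ?_ (hkey _ _ (h x hx) hU)
  filter_upwards [hfU, self_mem_nhdsWithin] with x' hx' hxs
  exact hkey _ _ (h x' hxs) hx'

/-! ### Horizontal lifts: uniqueness, construction, holonomy. -/

section Horizontal

variable [IsManifold 𝓘(ℝ, EP) ∞ P] {Ξ : OneForm EP P ℂ}

/-- The curve `c` is `C¹` on `[a, b]` and horizontal. -/
def IsHorizontalPiece (Ξ : OneForm EP P ℂ) (c : ℝ → P) (a b : ℝ) : Prop :=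
  IsC1Piece EP c a b ∧ ∀ t ∈ Ioo a b, Ξ (c t) (curveVelocity EP c t) = 0

omit [MulAction Circle P] [IsManifold 𝓘(ℝ, EP) ∞ P] in
theorem IsHorizontalPiece.congr {c c' : ℝ → P} {a b : ℝ} (h : IsHorizontalPiece Ξ c a b)
    (h' : EqOn c' c (Icc a b)) : IsHorizontalPiece Ξ c' a b := by
  refine ⟨h.1.congr h', fun t ht ↦ ?_⟩
  rw [Ξ.apply_velocity_congr (Filter.eventuallyEq_of_mem (Icc_mem_nhds ht.1 ht.2) h')]
  exact h.2 t ht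

omit [MulAction Circle P] [IsManifold 𝓘(ℝ, EP) ∞ P] in
theorem IsHorizontalPiece.comp_affine {c : ℝ → P} {a b k l : ℝ}
    (h : IsHorizontalPiece Ξ c (k * a + l) (k * b + l)) (hk : 0 < k) :
    IsHorizontalPiece Ξ (fun t ↦ c (k * t + l)) a b := by
  refine ⟨h.1.comp_affine hk, fun t ht ↦ ?_⟩
  rw [curveVelocity_comp_affine hk.ne', map_smul, h.2, smul_zero]
  constructor
  · nlinarith [ht.1]
  · nlinarith [ht.2]

-- A lift must also be horizontal at a breakpoint where it happens to be differentiable. There its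
-- velocity is the one-sided derivative of the piece to the right, on which `Ξ` vanishes by
-- continuity.
omit [TopologicalSpace M] in
theorem isHorizontalLift_of_reflTransGen (hΞ : IsCircleConnection Ξ)
    {γ : ℝ → M} {y : P} {c : ℝ → P}
    (h : ReflTransGen (IsHorizontalPiece Ξ c) 0 1) (hγ : ∀ t ∈ Icc (0 : ℝ) 1, p (c t) = γ t)
    (h0 : c 0 = y) : IsHorizontalLift p Ξ γ y c where
  piecewiseC1 := isPiecewiseC1Curve_iff.2 (ReflTransGen.mono
    (fun _ _ (h : IsHorizontalPiece Ξ c _ _) ↦ h.1) _ _ h)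
  proj := hγ
  start := h0
  horizontal t ht hd := by
    obtain ⟨a, b, hab, ht'⟩ := exists_piece_mem_Ico h ⟨ht.1.le, ht.2⟩
    have hlt := hab.1.1
    have hc := hΞ.smooth.continuousOn_velocityWithin hlt hab.1.2
    have h0 : EqOn (fun t ↦ Ξ (c t) (mfderivWithin 𝓘(ℝ, ℝ) 𝓘(ℝ, EP) c (Icc a b) t (1 : ℝ)))
        (fun _ ↦ 0) (Ioo a b) := fun s hs ↦ by
      simp only
      rw [mfderivWithin_Icc_apply_eq_curveVelocity hlt (Ioo_subset_Icc_self hs)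
        (hab.1.mdifferentiableAt hs)]
      exact hab.2 s hs
    have h1 := h0.of_subset_closure hc continuousOn_const Ioo_subset_Icc_self
      (closure_Ioo hlt.ne).superset (Ico_subset_Icc_self ht')
    simp only at h1
    rwa [mfderivWithin_Icc_apply_eq_curveVelocity hlt (Ico_subset_Icc_self ht') hd] at h1

omit [IsManifold 𝓘(ℝ, EP) ∞ P] in
theorem contMDiff_circle_smul (hp : IsPrincipalCircleBundle EM EP p) (w : Circle) :
    ContMDiff 𝓘(ℝ, EP) 𝓘(ℝ, EP) ∞ (fun y : P ↦ w • y) :=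
  hp.smooth_smul.contMDiff_smul.comp (contMDiff_const.prodMk contMDiff_id)

omit [IsManifold 𝓘(ℝ, EP) ∞ P] in
theorem mdifferentiableAt_const_smul_iff (hp : IsPrincipalCircleBundle EM EP p) (w : Circle)
    {c : ℝ → P} {t : ℝ} :
    MDifferentiableAt 𝓘(ℝ, ℝ) 𝓘(ℝ, EP) (fun t ↦ w • c t) t ↔
      MDifferentiableAt 𝓘(ℝ, ℝ) 𝓘(ℝ, EP) c t := by
  have key : ∀ (w : Circle) (c : ℝ → P), MDifferentiableAt 𝓘(ℝ, ℝ) 𝓘(ℝ, EP) c t →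
      MDifferentiableAt 𝓘(ℝ, ℝ) 𝓘(ℝ, EP) (fun t ↦ w • c t) t := fun w c hc ↦
    ((contMDiff_circle_smul hp w).mdifferentiableAt (by simp)).comp t hc
  refine ⟨fun h ↦ ?_, key w c⟩
  simpa using key w⁻¹ _ h

theorem IsHorizontalPiece.const_smul (hp : IsPrincipalCircleBundle EM EP p)
    (hΞ : IsCircleConnection Ξ) (w : Circle) {c : ℝ → P} {a b : ℝ}
    (h : IsHorizontalPiece Ξ c a b) : IsHorizontalPiece Ξ (fun t ↦ w • c t) a b := by
  refine ⟨h.1.comp ((contMDiff_circle_smul hp w).of_le (by simp)), fun t ht ↦ ?_⟩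
  rw [hΞ.apply_velocity_const_smul hp.smooth_smul w (h.1.mdifferentiableAt ht)]
  exact h.2 t ht

theorem IsHorizontalLift.const_smul (hp : IsPrincipalCircleBundle EM EP p)
    (hΞ : IsCircleConnection Ξ) (w : Circle) {γ : ℝ → M} {y : P} {c : ℝ → P}
    (h : IsHorizontalLift p Ξ γ y c) : IsHorizontalLift p Ξ γ (w • y) (fun t ↦ w • c t) where
  piecewiseC1 := isPiecewiseC1Curve_iff.2 (ReflTransGen.mono
    (fun _ _ (h : IsC1Piece EP c _ _) ↦ h.comp ((contMDiff_circle_smul hp w).of_le (by simp))) _ _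
    (isPiecewiseC1Curve_iff.1 h.piecewiseC1))
  proj t ht := by rw [hp.proj_smul, h.proj t ht]
  start := by rw [h.start]
  horizontal t ht hd := by
    rw [mdifferentiableAt_const_smul_iff hp] at hd
    rw [hΞ.apply_velocity_const_smul hp.smooth_smul w hd]
    exact h.horizontal t ht hd

/-- The horizontal lift of a curve with a given starting point is unique. -/
theorem IsHorizontalLift.unique (hp : IsPrincipalCircleBundle EM EP p)
    (hΞ : IsCircleConnection Ξ) {γ : ℝ → M} {y : P} {c c' : ℝ → P}
    (h : IsHorizontalLift p Ξ γ y c) (h' : IsHorizontalLift p Ξ γ y c') : c 1 = c' 1 := by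
  have hpc : ∀ t ∈ Icc (0 : ℝ) 1, p (c t) = p (c' t) := fun t ht ↦
    (h.proj t ht).trans (h'.proj t ht).symm
  have hR := isPiecewiseC1Curve_iff.1 h.piecewiseC1
  have hR' := isPiecewiseC1Curve_iff.1 h'.piecewiseC1
  obtain ⟨S, hS, hSd⟩ := exists_finite_forall_piece_mem_Ioo hR
  obtain ⟨S', hS', hSd'⟩ := exists_finite_forall_piece_mem_Ioo hR'
  -- The lifts differ by `d`. It is continuous and has zero derivative off the breakpoints of both
  -- lifts, hence is constant.
  set d : ℝ → Circle := fun t ↦ fiberDiv (c t) (c' t) with hd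
  have hdc : ∀ t ∈ Icc (0 : ℝ) 1, d t • c t = c' t := fun t ht ↦ hp.fiberDiv_smul (hpc t ht)
  have hcont : ContinuousOn (fun t ↦ (d t : ℂ)) (Icc 0 1) := fun t ht ↦ by
    have := hp.contMDiffWithinAt_fiberDiv (E := ℝ) (X := ℝ) (n := 0) ht
      (contMDiffOn_zero_iff.2 (continuousOn_of_reflTransGen hR) t ht)
      (contMDiffOn_zero_iff.2 (continuousOn_of_reflTransGen hR') t ht) hpc
    exact (Circle.contMDiff_coe (n := 0)).continuous.continuousAt.comp_continuousWithinAt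
      this.continuousWithinAt
  have hderiv : ∀ t ∈ Ioo (0 : ℝ) 1 \ (S ∪ S'), HasDerivAt (fun t ↦ (d t : ℂ)) 0 t := by
    intro t ht
    simp only [mem_sdiff, mem_union, not_or] at ht
    have hnhds : Icc (0 : ℝ) 1 ∈ 𝓝 t := Icc_mem_nhds ht.1.1 ht.1.2
    obtain ⟨a, b, hab, htab⟩ := hSd t ⟨ht.1, ht.2.1⟩
    obtain ⟨a', b', hab', htab'⟩ := hSd' t ⟨ht.1, ht.2.2⟩
    have hdt : ContMDiffAt 𝓘(ℝ, ℝ) (𝓡 1) 1 d t :=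
      (hp.contMDiffWithinAt_fiberDiv (E := ℝ) (X := ℝ) (n := 1) (Ioo_subset_Icc_self ht.1)
        (hab.2.contMDiffAt (Icc_mem_nhds htab.1 htab.2)).contMDiffWithinAt
        (hab'.2.contMDiffAt (Icc_mem_nhds htab'.1 htab'.2)).contMDiffWithinAt hpc).contMDiffAt hnhds
    have hdt' : DifferentiableAt ℝ (fun t ↦ (d t : ℂ)) t :=
      (contMDiffAt_iff_contDiffAt.1
        (Circle.contMDiff_coe.contMDiffAt.comp t hdt)).differentiableAt one_ne_zero
    -- Measured relative to `d t`, the angle is differentiable at `t`. Horizontality of both lifts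
    -- and the Leibniz rule then give `θ' = 0` there.
    set θ : ℝ → ℝ := fun s ↦ Complex.arg ((d s : ℂ) / d t) with hθ
    have hθd : DifferentiableAt ℝ θ t :=
      DifferentiableAt.comp (g := fun z : ℂ ↦ Complex.arg (z / d t)) (f := fun t ↦ (d t : ℂ)) t
        ((contDiffAt_arg_div_self (d t)).differentiableAt (by simp)) hdt'
    have hdθ : ∀ s, d s = d t * Circle.exp (θ s) := fun s ↦ Circle.eq_mul_exp_arg_div _ _
    have hcd := hab.mdifferentiableAt htab
    have hev : (fun s ↦ Circle.exp (θ s) • (d t • c s)) =ᶠ[𝓝 t] c' := by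
      filter_upwards [hnhds] with s hs
      rw [smul_smul, mul_comm, ← hdθ, hdc s hs]
    have h1 := hΞ.apply_velocity_exp_smul hp.smooth_smul
      ((mdifferentiableAt_const_smul_iff hp (d t)).2 hcd) hθd.hasDerivAt
    have h2 : Ξ (Circle.exp (θ t) • (d t • c t))
        (curveVelocity EP (fun s ↦ Circle.exp (θ s) • (d t • c s)) t) =
        Ξ (c' t) (curveVelocity EP c' t) := Ξ.apply_velocity_congr hev
    rw [h2, h'.horizontal t ht.1 (hab'.mdifferentiableAt htab'),
      hΞ.apply_velocity_const_smul hp.smooth_smul _ hcd, h.horizontal t ht.1 hcd, add_zero] at h1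
    have h3 : deriv θ t = 0 := by simpa using h1.symm
    have h4 : HasDerivAt θ 0 t := h3 ▸ hθd.hasDerivAt
    have h5 : (fun s ↦ (d s : ℂ)) = fun s ↦ (d t : ℂ) * Complex.exp (θ s * Complex.I) := by
      ext s
      rw [hdθ s, Circle.coe_mul, Circle.coe_exp]
    rw [h5]
    have := ((h4.ofReal_comp.mul_const Complex.I).cexp).const_mul (d t : ℂ)
    simpa using this
  have hint := MeasureTheory.integral_eq_of_hasDerivAt_off_countable_of_le (fun t ↦ (d t : ℂ))
    (fun _ ↦ 0) zero_le_one (hS.union hS').countable hcont hderiv (by simp)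
  have hd1 : d 1 = d 0 := by
    rw [intervalIntegral.integral_zero] at hint
    exact Circle.ext (sub_eq_zero.1 hint.symm)
  have hd0 : d 0 = 1 := by
    simp only [hd]
    rw [h.start, h'.start]
    simpa using hp.fiberDiv_smul_self 1 y
  rw [← hdc 1 (by simp), hd1, hd0, one_smul]

/-- A `C¹` curve in the total space becomes horizontal after it is moved along the fibres by
the integral of the connection form. -/
theorem IsC1Piece.isHorizontalPiece_exp_smul (hp : IsPrincipalCircleBundle EM EP p)
    (hΞ : IsCircleConnection Ξ) {c : ℝ → P} {a b : ℝ} (h : IsC1Piece EP c a b) {H : ℝ → ℝ}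
    (hH : ∀ t ∈ Icc a b, H t = H a + ∫ s in a..t, (Ξ (c s) (curveVelocity EP c s)).im) :
    IntervalIntegrable (fun t ↦ (Ξ (c t) (curveVelocity EP c t)).im) MeasureTheory.volume a b ∧
    IsHorizontalPiece Ξ (fun t ↦ Circle.exp (-H t) • c t) a b := by
  have hg := Complex.continuous_im.comp_continuousOn
    (hΞ.smooth.continuousOn_velocityWithin h.1 h.2)
  obtain ⟨h1, h2, h3⟩ := contDiffOn_primitive_of_eqOn_Ioo
    (h := fun t ↦ (Ξ (c t) (curveVelocity EP c t)).im) h.1 hg (fun t ht ↦ by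
      simp only [Function.comp]
      rw [mfderivWithin_Icc_apply_eq_curveVelocity h.1 (Ioo_subset_Icc_self ht)
        (h.mdifferentiableAt ht)]) hH
  refine ⟨h1, ⟨h.1, ?_⟩, fun t ht ↦ ?_⟩
  · exact ((contMDiff_exp_smul hp.smooth_smul).of_le (by simp)).comp_contMDiffOn
      (h2.neg.contMDiffOn.prodMk h.2)
  · rw [hΞ.apply_velocity_exp_smul hp.smooth_smul (θ := fun t ↦ -H t)
      (h.mdifferentiableAt ht) (h3 t ht).fun_neg]
    apply Complex.ext <;> simp [hΞ.imaginary]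

/-- The holonomy can be read off from a single horizontal lift. -/
theorem equivariantHolonomy_eq (hp : IsPrincipalCircleBundle EM EP p)
    (hΞ : IsCircleConnection Ξ) {G : Type*} [SMul G P]
    (hcomm : ∀ (φ : G) (z : Circle) (y : P), φ • z • y = z • φ • y)
    {φ : G} {γ : ℝ → M} {y : P} {c : ℝ → P} {u : Circle} (hy : p y = γ 0)
    (hc : IsHorizontalLift p Ξ γ y c) (hu : c 1 = u • φ • y) :
    equivariantHolonomy p Ξ φ γ = u := by
  -- Every point of the fibre is a circle translate of `y`, and translating the lift keeps `u`,
  -- because the actions of `Circle` and `G` commute.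
  have hspec : IsEquivariantHolonomy p Ξ φ γ u := by
    intro y' hy'
    have hw := hp.fiberDiv_smul (hy.trans hy'.symm)
    refine ⟨fun t ↦ fiberDiv y y' • c t, ?_, ?_⟩
    · have := hc.const_smul hp hΞ (fiberDiv y y')
      rwa [hw] at this
    · simp only
      rw [hu, smul_comm, ← hcomm, hw]
  obtain ⟨c', hc', hu'⟩ := Classical.epsilon_spec
    (p := IsEquivariantHolonomy p Ξ φ γ) ⟨u, hspec⟩ y hy
  rw [hc'.unique hp hΞ hc, hu] at hu'
  exact (hp.smul_left_cancel hu').symm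

end Horizontal

end PrincipalBundle

/-! ### From an equivariant section to the invariant form. -/

section GlobalSection

open Relation

variable {EM : Type*} [NormedAddCommGroup EM] [NormedSpace ℝ EM]
  {M : Type*} [TopologicalSpace M] [ChartedSpace EM M]
  {EP : Type*} [NormedAddCommGroup EP] [NormedSpace ℝ EP]
  {P : Type*} [TopologicalSpace P] [ChartedSpace EP P] [IsManifold 𝓘(ℝ, EP) ∞ P]
  [MulAction Circle P] {p : P → M} {Ξ : OneForm EP P ℂ}

/-- A piecewise `C¹` curve in the total space becomes horizontal after it is moved along the
fibres by the integral of the connection form. -/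
theorem reflTransGen_isHorizontalPiece_exp_smul (hp : IsPrincipalCircleBundle EM EP p)
    (hΞ : IsCircleConnection Ξ) {c : ℝ → P} {a b : ℝ} (h : ReflTransGen (IsC1Piece EP c) a b) :
    IntervalIntegrable (fun t ↦ (Ξ (c t) (curveVelocity EP c t)).im) MeasureTheory.volume a b ∧
    ReflTransGen (IsHorizontalPiece Ξ
      (fun t ↦ Circle.exp (-∫ s in a..t, (Ξ (c s) (curveVelocity EP c s)).im) • c t)) a b := by
  induction h with
  | refl => exact ⟨.refl, .refl⟩
  | @tail b d h1 h2 ih =>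
    have hi := (h2.isHorizontalPiece_exp_smul hp hΞ
      (H := fun t ↦ ∫ s in b..t, (Ξ (c s) (curveVelocity EP c s)).im) (by simp)).1
    refine ⟨ih.1.trans hi, ih.2.tail (h2.isHorizontalPiece_exp_smul hp hΞ fun t ht ↦ ?_).2⟩
    -- On the last piece the integral from `a` is its value at `b` plus the integral from `b`.
    refine (intervalIntegral.integral_add_adjacent_intervals ih.1 (hi.mono_set ?_)).symm
    rw [uIcc_of_le ht.1, uIcc_of_le h2.1.le]
    exact Icc_subset_Icc_right ht.2

variable [IsManifold 𝓘(ℝ, EM) ∞ M]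

/-- The real 1-form `-(2π)⁻¹ Im s^*Ξ` for a section `s`. -/
noncomputable def sectionForm (EM : Type*) [NormedAddCommGroup EM] [NormedSpace ℝ EM]
    {M : Type*} [TopologicalSpace M] [ChartedSpace EM M]
    (Ξ : OneForm EP P ℂ) (s : M → P) : OneForm EM M ℝ :=
  fun x ↦ ((-(2 * Real.pi)⁻¹) • Complex.imCLM : ℂ →L[ℝ] ℝ).comp (Ξ.pullback (E' := EM) s x)

omit [MulAction Circle P] in
theorem sectionForm_isSmooth (hΞ : Ξ.IsSmooth) {s : M → P}
    (hs : ContMDiff 𝓘(ℝ, EM) 𝓘(ℝ, EP) ∞ s) : (sectionForm EM Ξ s).IsSmooth :=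
  (hΞ.pullback hs).clm_comp _

-- Differentiate `s ∘ φ = φ ∘ s` by the chain rule on both sides and use the invariance of `Ξ`.
omit [MulAction Circle P] [IsManifold 𝓘(ℝ, EM) ∞ M] [IsManifold 𝓘(ℝ, EP) ∞ P] in
theorem sectionForm_isInvariant {G : Type*} [SMul G M] [SMul G P]
    (hM : ∀ φ : G, ContMDiff 𝓘(ℝ, EM) 𝓘(ℝ, EM) ∞ (fun x : M ↦ φ • x))
    (hP : ∀ φ : G, ContMDiff 𝓘(ℝ, EP) 𝓘(ℝ, EP) ∞ (fun y : P ↦ φ • y))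
    (hΞ : Ξ.IsInvariant G) {s : M → P}
    (hs : ContMDiff 𝓘(ℝ, EM) 𝓘(ℝ, EP) ∞ s) (hsG : ∀ (φ : G) x, s (φ • x) = φ • s x) :
    (sectionForm EM Ξ s).IsInvariant G := by
  intro φ x v
  refine congrArg ((-(2 * Real.pi)⁻¹) • Complex.imCLM : ℂ →L[ℝ] ℝ) ?_
  have h1 := mfderiv_comp x (hs.mdifferentiableAt (by simp) (x := φ • x))
    ((hM φ).mdifferentiableAt (by simp) (x := x))
  have h2 := mfderiv_comp x ((hP φ).mdifferentiableAt (by simp) (x := s x))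
    (hs.mdifferentiableAt (by simp) (x := x))
  have h3 : s ∘ (fun x ↦ φ • x) = (fun y ↦ φ • y) ∘ s := funext fun x ↦ hsG φ x
  rw [h3] at h1
  refine Eq.trans ?_ (hΞ φ (s x) (mfderiv 𝓘(ℝ, EM) 𝓘(ℝ, EP) s x v))
  exact congrArg₂ (fun (y : P) (v : EP) ↦ (Ξ y : EP →L[ℝ] ℂ) v) (hsG φ x)
    (congrArg (fun L : EM →L[ℝ] EP ↦ L v) (h1.symm.trans h2))

omit [IsManifold 𝓘(ℝ, EM) ∞ M] in
theorem equivariantHolonomy_eq_of_section (hp : IsPrincipalCircleBundle EM EP p)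
    (hΞ : IsCircleConnection Ξ) {G : Type*} [SMul G M] [SMul G P]
    (hcomm : ∀ (φ : G) (z : Circle) (y : P), φ • z • y = z • φ • y) {s : M → P}
    (hs : ContMDiff 𝓘(ℝ, EM) 𝓘(ℝ, EP) ∞ s) (hps : ∀ x, p (s x) = x)
    (hsG : ∀ (φ : G) x, s (φ • x) = φ • s x) {φ : G} {γ : ℝ → M} (hγ : γ ∈ twistedLoops EM M φ) :
    equivariantHolonomy p Ξ φ γ =
      Circle.exp (2 * Real.pi * (sectionForm EM Ξ s).lineIntegral γ) := by
  have h1 : ReflTransGen (IsC1Piece EP (s ∘ γ)) 0 1 := ReflTransGen.mono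
    (fun _ _ (h : IsC1Piece EM γ _ _) ↦ h.comp (hs.of_le (by simp))) _ _
    (isPiecewiseC1Curve_iff.1 hγ.1)
  have h2 := isHorizontalLift_of_reflTransGen (p := p) (γ := γ) hΞ
    (reflTransGen_isHorizontalPiece_exp_smul hp hΞ h1).2
    (fun t _ ↦ by rw [hp.proj_smul]; exact hps _) rfl
  have h3 : ∀ t, (Ξ ((s ∘ γ) t) (curveVelocity EP (s ∘ γ) t)).im =
      -(2 * Real.pi * sectionForm EM Ξ s (γ t) (curveVelocity EM γ t)) := by
    intro t
    have h4 : sectionForm EM Ξ s (γ t) (curveVelocity EM γ t) =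
      -(2 * Real.pi)⁻¹ * (Ξ (s (γ t)) (mfderiv 𝓘(ℝ, EM) 𝓘(ℝ, EP) s (γ t)
        (curveVelocity EM γ t))).im := rfl
    by_cases hd : MDifferentiableAt 𝓘(ℝ, ℝ) 𝓘(ℝ, EM) γ t
    · rw [h4, curveVelocity_comp (hs.mdifferentiableAt (by simp)) hd]
      have := Real.pi_ne_zero
      simp only [Function.comp]
      field_simp
    -- As `γ = p ∘ s ∘ γ`, the curve `s ∘ γ` is not differentiable where `γ` is not, so both
    -- velocities take the default value zero.
    · have hd' : ¬ MDifferentiableAt 𝓘(ℝ, ℝ) 𝓘(ℝ, EP) (s ∘ γ) t := fun h ↦ hd <| by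
        have h5 := (hp.smooth_proj.mdifferentiableAt (by simp)).comp t h
        refine h5.congr_of_eventuallyEq (Filter.Eventually.of_forall fun t ↦ (hps (γ t)).symm)
      rw [curveVelocity_of_not_mdifferentiableAt hd, curveVelocity_of_not_mdifferentiableAt hd']
      simp
  refine equivariantHolonomy_eq hp hΞ hcomm ?_ h2 ?_
  · rw [hp.proj_smul]; exact hps _
  · have h6 : ∫ t in (0 : ℝ)..1, (Ξ ((s ∘ γ) t) (curveVelocity EP (s ∘ γ) t)).im =
        -(2 * Real.pi * (sectionForm EM Ξ s).lineIntegral γ) := by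
      simp only [h3, intervalIntegral.integral_neg, intervalIntegral.integral_const_mul]
      rfl
    simp only [h6, neg_neg, intervalIntegral.integral_same, neg_zero, Circle.exp_zero, one_smul]
    rw [Function.comp_apply, Function.comp_apply, hγ.2, hsG]

end GlobalSection

/-! ### Parallel transport for the twisted connection. -/

section Transport

open Relation

variable {EM : Type*} [NormedAddCommGroup EM] [NormedSpace ℝ EM]
  {M : Type*} [TopologicalSpace M] [ChartedSpace EM M]

/-- The velocity depends only on the germ of the curve, so what happens at the endpoints and outside
the interval is irrelevant. -/
theorem OneForm.integral_velocity_congr (β : OneForm EM M ℝ) {γ γ' : ℝ → M} {a b : ℝ} (hab : a ≤ b)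
    (h : EqOn γ γ' (Ioo a b)) :
    ∫ t in a..b, β (γ t) (curveVelocity EM γ t) = ∫ t in a..b, β (γ' t) (curveVelocity EM γ' t) := by
  refine intervalIntegral.integral_congr_ae ?_
  have : ∀ᵐ s : ℝ, s ≠ b := by simp [MeasureTheory.ae_iff, MeasureTheory.measure_singleton]
  filter_upwards [this] with s hs hst
  rw [uIoc_of_le hab] at hst
  exact β.apply_velocity_congr
    (Filter.eventuallyEq_of_mem (Ioo_mem_nhds hst.1 (lt_of_le_of_ne hst.2 hs)) h)

theorem OneForm.integral_velocity_comp_affine (β : OneForm EM M ℝ) (γ : ℝ → M) {k : ℝ} (hk : k ≠ 0)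
    (l a b : ℝ) :
    ∫ t in a..b, β (γ (k * t + l)) (curveVelocity EM (fun t ↦ γ (k * t + l)) t) =
      ∫ t in (k * a + l)..(k * b + l), β (γ t) (curveVelocity EM γ t) := by
  rw [← intervalIntegral.mul_integral_comp_mul_add, ← intervalIntegral.integral_const_mul]
  refine intervalIntegral.integral_congr fun t _ ↦ ?_
  change β _ (curveVelocity EM (fun t ↦ γ (k * t + l)) t) = k * β _ (curveVelocity EM γ (k * t + l))
  rw [curveVelocity_comp_affine hk, map_smul, smul_eq_mul]

theorem OneForm.IsSmooth.intervalIntegrable_velocity [IsManifold 𝓘(ℝ, EM) ∞ M]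
    {β : OneForm EM M ℝ} (hβ : β.IsSmooth) {γ : ℝ → M} {a b : ℝ}
    (h : ReflTransGen (IsC1Piece EM γ) a b) :
    IntervalIntegrable (fun t ↦ β (γ t) (curveVelocity EM γ t)) MeasureTheory.volume a b := by
  induction h with
  | refl => exact .refl
  | @tail b c _ h ih =>
    refine ih.trans (contDiffOn_primitive_of_eqOn_Ioo
      (H := fun t ↦ ∫ s in b..t, β (γ s) (curveVelocity EM γ s)) h.1
      (hβ.continuousOn_velocityWithin h.1 h.2) (fun t ht ↦ ?_) (by simp)).1
    rw [mfderivWithin_Icc_apply_eq_curveVelocity h.1 (Ioo_subset_Icc_self ht)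
        (h.mdifferentiableAt ht)]

variable [IsManifold 𝓘(ℝ, EM) ∞ M]
  {EP : Type*} [NormedAddCommGroup EP] [NormedSpace ℝ EP]
  {P : Type*} [TopologicalSpace P] [ChartedSpace EP P] [IsManifold 𝓘(ℝ, EP) ∞ P]
  [MulAction Circle P] {p : P → M} {Ξ : OneForm EP P ℂ} {β : OneForm EM M ℝ}

/-- `y'` is obtained from `y` by parallel transport, for the connection `Ξ + 2πi p^*β`, along
a `C¹` curve. -/
def TransportStep (p : P → M) (Ξ : OneForm EP P ℂ) (β : OneForm EM M ℝ) (y y' : P) : Prop :=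
  ∃ c : ℝ → P, IsHorizontalPiece Ξ c 0 1 ∧ c 0 = y ∧
    y' = Circle.exp (-(2 * Real.pi * β.lineIntegral (p ∘ c))) • c 1

/-- The steps are concatenated into a single horizontal curve. The interval `[0, T]` grows by `1`
with each step, which postpones rescaling to one final change of parameter. -/
theorem exists_curve_of_reflTransGen_transportStep (hp : IsPrincipalCircleBundle EM EP p)
    (hΞ : IsCircleConnection Ξ) (hβ : β.IsSmooth) {y y' : P}
    (h : ReflTransGen (TransportStep p Ξ β) y y') :
    ∃ (T : ℝ) (c : ℝ → P), 0 < T ∧ ReflTransGen (IsHorizontalPiece Ξ c) 0 T ∧ c 0 = y ∧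
      y' = Circle.exp (-(2 * Real.pi *
        ∫ t in (0 : ℝ)..T, β ((p ∘ c) t) (curveVelocity EM (p ∘ c) t))) • c T := by
  induction h with
  | refl =>
    -- The empty chain gets a constant curve of length `1`, not `0`: the later rescaling divides by
    -- `T`.
    refine ⟨1, fun _ ↦ y, one_pos, .single ⟨⟨one_pos, contMDiffOn_const⟩, fun t _ ↦ ?_⟩, rfl, ?_⟩
    · rw [curveVelocity, mfderiv_const]
      exact map_zero _
    · have : ∀ t, β ((p ∘ fun _ : ℝ ↦ y) t) (curveVelocity EM (p ∘ fun _ : ℝ ↦ y) t) = 0 := by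
        intro t
        change β _ (mfderiv 𝓘(ℝ, ℝ) 𝓘(ℝ, EM) (fun _ ↦ p y) t (1 : ℝ)) = 0
        rw [mfderiv_const]
        exact map_zero _
      simp only [this, intervalIntegral.integral_zero, mul_zero, neg_zero, Circle.exp_zero, one_smul]
  | @tail y' y'' _ h ih =>
    obtain ⟨T, c, hT, hc, hc0, hcT⟩ := ih
    obtain ⟨c', hc', hc0', hc1'⟩ := h
    set w := Circle.exp (-(2 * Real.pi *
        ∫ t in (0 : ℝ)..T, β ((p ∘ c) t) (curveVelocity EM (p ∘ c) t))) with hw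
    -- The next curve starts at `w • c T`; translation by `w⁻¹` attaches it to `c` without changing
    -- its projection.
    let f : ℝ → P := fun t ↦ if t ≤ T then c t else w⁻¹ • c' (1 * t + -T)
    have hf1 : EqOn f c (Iic T) := fun t ht ↦ if_pos ht
    have hf2 : EqOn f (fun t ↦ w⁻¹ • c' (1 * t + -T)) (Ici T) := by
      intro t ht
      rcases (mem_Ici.1 ht).eq_or_lt with rfl | ht
      · simp [f, hc0', hcT]
      · simp [f, not_le.2 ht]
    have hpf : EqOn (p ∘ f) (fun t ↦ (p ∘ c') (1 * t + -T)) (Ici T) := fun t ht ↦ by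
      simp only [Function.comp]
      rw [hf2 ht, hp.proj_smul]
    have h1 : ReflTransGen (IsHorizontalPiece Ξ f) 0 T :=
      reflTransGen_congr (fun _ _ h ↦ h.1.1) hc fun a b _ hb h ↦
        h.congr (hf1.mono fun t ht ↦ ht.2.trans hb)
    have h2 : IsHorizontalPiece Ξ f T (T + 1) := by
      have h3 : IsHorizontalPiece Ξ c' (1 * T + -T) (1 * (T + 1) + -T) := by simpa using hc'
      exact ((h3.comp_affine one_pos).const_smul hp hΞ w⁻¹).congr
        (hf2.mono fun t ht ↦ ht.1)
    have hpc : ∀ a b, ReflTransGen (IsHorizontalPiece Ξ f) a b →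
        ReflTransGen (IsC1Piece EM (p ∘ f)) a b := fun a b h ↦ ReflTransGen.mono
      (fun _ _ (h : IsHorizontalPiece Ξ f _ _) ↦ h.1.comp (hp.smooth_proj.of_le (by simp))) _ _ h
    have hI : ∫ t in (0 : ℝ)..(T + 1), β ((p ∘ f) t) (curveVelocity EM (p ∘ f) t) =
        (∫ t in (0 : ℝ)..T, β ((p ∘ c) t) (curveVelocity EM (p ∘ c) t)) +
          β.lineIntegral (p ∘ c') := by
      rw [← intervalIntegral.integral_add_adjacent_intervals
        (hβ.intervalIntegrable_velocity (hpc _ _ h1))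
        (hβ.intervalIntegrable_velocity (hpc _ _ (.single h2)))]
      congr 1
      · exact β.integral_velocity_congr hT.le fun t ht ↦ congrArg p (hf1 ht.2.le)
      · rw [β.integral_velocity_congr (by simp) (hpf.mono fun t ht ↦ ht.1.le),
          β.integral_velocity_comp_affine (p ∘ c') one_ne_zero (-T) T (T + 1)]
        simp [OneForm.lineIntegral]
    refine ⟨T + 1, f, by linarith, h1.tail h2, (hf1 hT.le).trans hc0, ?_⟩
    rw [hI, hc1', hf2 (by simp : T + 1 ∈ Ici T), mul_add, neg_add, Circle.exp_add, ← hw, smul_smul,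
      mul_comm w, mul_inv_cancel_right, one_mul, add_neg_cancel_comm]

/-- If the holonomy of `Ξ` is that of `-2πiβ`, the transport for `Ξ + 2πi p^*β` from a point `y`
to a point over `φ • p y` ends at `φ • y`. -/
theorem eq_smul_of_reflTransGen_transportStep (hp : IsPrincipalCircleBundle EM EP p)
    (hΞ : IsCircleConnection Ξ) (hβ : β.IsSmooth) {G : Type*} [SMul G M] [SMul G P]
    (hpG : ∀ (φ : G) (y : P), p (φ • y) = φ • p y)
    (hcomm : ∀ (φ : G) (z : Circle) (y : P), φ • z • y = z • φ • y)
    (hol : ∀ (φ : G), ∀ γ ∈ twistedLoops EM M φ,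
      equivariantHolonomy p Ξ φ γ = Circle.exp (2 * Real.pi * β.lineIntegral γ))
    {φ : G} {y y' : P} (h : ReflTransGen (TransportStep p Ξ β) y y') (hφ : p y' = φ • p y) :
    y' = φ • y := by
  obtain ⟨T, c, hT, hc, hc0, hcT⟩ := exists_curve_of_reflTransGen_transportStep hp hΞ hβ h
  let f : ℝ → P := fun t ↦ c (T * t + 0)
  have hf : ReflTransGen (IsHorizontalPiece Ξ f) 0 1 := by
    have := hc.lift (p := IsHorizontalPiece Ξ f) (fun t ↦ T⁻¹ * t) fun a b hab ↦ by
      refine IsHorizontalPiece.comp_affine ?_ hT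
      simpa [mul_inv_cancel_left₀ hT.ne'] using hab
    simpa only [Function.onFun, mul_zero, inv_mul_cancel₀ hT.ne'] using this
  have hf0 : f 0 = y := by simp [f, hc0]
  have hf1 : f 1 = c T := by simp [f]
  have hpcT : p (c T) = φ • p y := by rw [← hφ, hcT, hp.proj_smul]
  have hlift : IsHorizontalLift p Ξ (p ∘ f) y f :=
    isHorizontalLift_of_reflTransGen hΞ hf (fun _ _ ↦ rfl) hf0
  have hloop : p ∘ f ∈ twistedLoops EM M φ := by
    refine ⟨isPiecewiseC1Curve_iff.2 (ReflTransGen.mono (fun _ _ (h : IsHorizontalPiece Ξ f _ _) ↦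
      h.1.comp (hp.smooth_proj.of_le (by simp))) _ _ hf), ?_⟩
    simp only [Function.comp, hf0, hf1, hpcT]
  -- The quotient in the fibre over `φ • p y` is the holonomy of the projected loop, which the
  -- correction factor in `hcT` cancels.
  have hu : f 1 = fiberDiv (φ • y) (c T) • φ • y := by
    rw [hf1, hp.fiberDiv_smul]
    rw [hpG, hpcT]
  have h1 := equivariantHolonomy_eq hp hΞ hcomm (by simp [hf0]) hlift hu
  rw [hol φ _ hloop] at h1
  have h2 : β.lineIntegral (p ∘ f) =
      ∫ t in (0 : ℝ)..T, β ((p ∘ c) t) (curveVelocity EM (p ∘ c) t) := by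
    have := β.integral_velocity_comp_affine (p ∘ c) hT.ne' 0 0 1
    simp only [mul_zero, mul_one, add_zero] at this
    rw [← this, OneForm.lineIntegral]
    rfl
  rw [hcT, ← hf1, hu, ← h1, h2, smul_smul, ← Circle.exp_add, neg_add_cancel, Circle.exp_zero,
    one_smul]

end Transport

/-! ### Transport along segments in a chart. -/

section LocalTransport

open Relation

variable {EM : Type*} [NormedAddCommGroup EM] [NormedSpace ℝ EM]
  {M : Type*} [TopologicalSpace M] [ChartedSpace EM M] [IsManifold 𝓘(ℝ, EM) ∞ M]
  {EP : Type*} [NormedAddCommGroup EP] [NormedSpace ℝ EP]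
  {P : Type*} [TopologicalSpace P] [ChartedSpace EP P] [IsManifold 𝓘(ℝ, EP) ∞ P]
  [MulAction Circle P] {p : P → M} {Ξ : OneForm EP P ℂ} {β : OneForm EM M ℝ}

omit [IsManifold 𝓘(ℝ, EP) ∞ P] in
/-- Around every point there are a convex open subset of a chart and a smooth section over it. -/
theorem IsPrincipalCircleBundle.exists_localSection (hp : IsPrincipalCircleBundle EM EP p) (x : M) :
    ∃ (V : Set EM) (σ : EM → P), IsOpen V ∧ Convex ℝ V ∧ chartAt EM x x ∈ V ∧
      V ⊆ (chartAt EM x).target ∧ ContMDiffOn 𝓘(ℝ, EM) 𝓘(ℝ, EP) ∞ σ V ∧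
      ∀ u ∈ V, p (σ u) = (chartAt EM x).symm u := by
  obtain ⟨U, hUo, hU, Ψ, hs, ht, h1, -⟩ := hp.exists_localTriv x
  set e := chartAt EM x
  have hopen : IsOpen (e.target ∩ e.symm ⁻¹' U) := e.isOpen_inter_preimage_symm hUo
  obtain ⟨r, hr, hV⟩ := Metric.isOpen_iff.1 hopen (e x)
    ⟨e.map_source (mem_chart_source EM x), by
      rw [mem_preimage, e.left_inv (mem_chart_source EM x)]; exact hU⟩
  have hmem : ∀ u ∈ Metric.ball (e x) r, (e.symm u, (1 : Circle)) ∈ Ψ.target := fun u hu ↦ by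
    rw [ht]; exact ⟨(hV hu).2, mem_univ _⟩
  refine ⟨Metric.ball (e x) r, fun u ↦ Ψ.symm (e.symm u, 1), Metric.isOpen_ball, convex_ball _ _,
    Metric.mem_ball_self hr, fun u hu ↦ (hV hu).1, ?_, fun u hu ↦ ?_⟩
  · refine Ψ.contMDiffOn_invFun.comp (ContMDiffOn.prodMk ?_ contMDiffOn_const) hmem
    exact (contMDiffOn_chart_symm (I := 𝓘(ℝ, EM)) (n := ∞) (x := x)).mono fun u hu ↦ (hV hu).1
  · have h2 := Ψ.map_target (hmem u hu)
    rw [hs] at h2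
    have h3 := h1 _ h2
    have h4 := congrArg Prod.fst (Ψ.right_inv (hmem u hu))
    exact h3.symm.trans h4

omit [IsManifold 𝓘(ℝ, EP) ∞ P] in
theorem IsPrincipalCircleBundle.proj_surjective (hp : IsPrincipalCircleBundle EM EP p) :
    Function.Surjective p := fun x ↦ by
  obtain ⟨V, σ, -, -, hV, -, -, h⟩ := hp.exists_localSection x
  exact ⟨_, (h _ hV).trans ((chartAt EM x).left_inv (mem_chart_source EM x))⟩

/-- The connection form of `Ξ + 2πi p^*β`, divided by `i`, in the local section `σ` over the
local parametrization `f` of the base. -/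
noncomputable def localConnectionForm (Ξ : OneForm EP P ℂ) (β : OneForm EM M ℝ) (σ : EM → P)
    (f : EM → M) : EM → EM →L[ℝ] ℝ :=
  fun u ↦ Complex.imCLM.comp (Ξ.pullback (E' := EM) σ u : EM →L[ℝ] ℂ) +
    (2 * Real.pi) • (β.pullback (E' := EM) f u : EM →L[ℝ] ℝ)

omit [MulAction Circle P] in
theorem contDiffOn_localConnectionForm (hΞ : Ξ.IsSmooth) (hβ : β.IsSmooth) {σ : EM → P}
    {f : EM → M} {V : Set EM} (hV : IsOpen V) (hσ : ContMDiffOn 𝓘(ℝ, EM) 𝓘(ℝ, EP) ∞ σ V)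
    (hf : ContMDiffOn 𝓘(ℝ, EM) 𝓘(ℝ, EM) ∞ f V) :
    ContDiffOn ℝ ∞ (localConnectionForm Ξ β σ f) V := by
  intro u hu
  have h1 := hΞ.contDiffAt_pullback ((hσ u hu).contMDiffAt (hV.mem_nhds hu))
  have h2 := hβ.contDiffAt_pullback ((hf u hu).contMDiffAt (hV.mem_nhds hu))
  exact ((contDiffAt_const.clm_comp h1).add (h2.const_smul (2 * Real.pi))).contDiffWithinAt

-- The segment, lifted by `w • σ`, is made horizontal by rotating through the integral of `Im Ξ`.
-- Together with the correction by `β`, the total angle is the curve integral of the local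
-- connection form.
open AffineMap in
theorem transportStep_segment (hp : IsPrincipalCircleBundle EM EP p)
    (hΞ : IsCircleConnection Ξ) (hβ : β.IsSmooth) {σ : EM → P} {f : EM → M} {V : Set EM}
    (hV : IsOpen V) (hVc : Convex ℝ V) (hσ : ContMDiffOn 𝓘(ℝ, EM) 𝓘(ℝ, EP) ∞ σ V)
    (hf : ContMDiffOn 𝓘(ℝ, EM) 𝓘(ℝ, EM) ∞ f V) (hpσ : ∀ u ∈ V, p (σ u) = f u)
    {u u' : EM} (hu : u ∈ V) (hu' : u' ∈ V) (w : Circle) :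
    TransportStep p Ξ β (w • σ u)
      (Circle.exp (-∫ᶜ v in .segment u u', localConnectionForm Ξ β σ f v) • w • σ u') := by
  let l : ℝ → EM := fun t ↦ lineMap u u' t
  have hl : ∀ t ∈ Icc (0 : ℝ) 1, l t ∈ V := fun t ht ↦ hVc.lineMap_mem hu hu' ht
  have hlc : IsC1Piece EM l 0 1 :=
    ⟨one_pos, ContDiff.contMDiff (by simp only [l, lineMap_apply_module']; fun_prop) |>.contMDiffOn⟩
  have hld : ∀ t, curveVelocity EM l t = u' - u := fun t ↦ by
    have h1 : HasDerivAt l (u' - u) t := AffineMap.hasDerivAt_lineMap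
    refine (congrArg (fun L : ℝ →L[ℝ] EM ↦ L (1 : ℝ)) h1.hasFDerivAt.hasMFDerivAt.mfderiv).trans ?_
    simp
  have hσl : IsC1Piece EP (fun t ↦ w • (σ ∘ l) t) 0 1 := by
    refine IsC1Piece.comp (γ := σ ∘ l) ⟨one_pos, ?_⟩ ((contMDiff_circle_smul hp w).of_le (by simp))
    exact (hσ.of_le (by simp)).comp hlc.2 hl
  have hfl : IsC1Piece EM (f ∘ l) 0 1 := ⟨one_pos, (hf.of_le (by simp)).comp hlc.2 hl⟩
  set H : ℝ → ℝ := fun t ↦ ∫ s in (0 : ℝ)..t, (Ξ (w • (σ ∘ l) s)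
    (curveVelocity EP (fun t ↦ w • (σ ∘ l) t) s)).im with hH
  obtain ⟨hi, hc⟩ := hσl.isHorizontalPiece_exp_smul hp hΞ (H := H) (by simp [hH])
  have hσd : ∀ t ∈ Icc (0 : ℝ) 1, MDifferentiableAt 𝓘(ℝ, EM) 𝓘(ℝ, EP) σ (l t) := fun t ht ↦
    ((hσ _ (hl t ht)).contMDiffAt (hV.mem_nhds (hl t ht))).mdifferentiableAt (by simp)
  have hfd : ∀ t ∈ Icc (0 : ℝ) 1, MDifferentiableAt 𝓘(ℝ, EM) 𝓘(ℝ, EM) f (l t) := fun t ht ↦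
    ((hf _ (hl t ht)).contMDiffAt (hV.mem_nhds (hl t ht))).mdifferentiableAt (by simp)
  refine ⟨_, hc, by simp [hH, l], ?_⟩
  have hβl : β.lineIntegral (p ∘ fun t ↦ Circle.exp (-H t) • w • (σ ∘ l) t) =
      ∫ t in (0 : ℝ)..1, β ((f ∘ l) t) (curveVelocity EM (f ∘ l) t) :=
    β.integral_velocity_congr zero_le_one fun t ht ↦ by
      simp only [Function.comp, hp.proj_smul]
      exact hpσ _ (hl t (Ioo_subset_Icc_self ht))
  have key : ∫ᶜ v in .segment u u', localConnectionForm Ξ β σ f v =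
      H 1 + 2 * Real.pi * ∫ t in (0 : ℝ)..1, β ((f ∘ l) t) (curveVelocity EM (f ∘ l) t) := by
    rw [curveIntegral_segment, hH, ← intervalIntegral.integral_const_mul,
      ← intervalIntegral.integral_add hi ((hβ.intervalIntegrable_velocity (.single hfl)).const_mul _)]
    refine intervalIntegral.integral_congr_ae ?_
    have : ∀ᵐ s : ℝ, s ≠ 1 := by simp [MeasureTheory.ae_iff, MeasureTheory.measure_singleton]
    filter_upwards [this] with t ht1 ht
    rw [uIoc_of_le zero_le_one] at ht
    have ht : t ∈ Ioo (0 : ℝ) 1 := ⟨ht.1, lt_of_le_of_ne ht.2 ht1⟩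
    have ht' := Ioo_subset_Icc_self ht
    have hlt := hlc.mdifferentiableAt ht
    have e1 := hΞ.apply_velocity_const_smul hp.smooth_smul w ((hσd t ht').comp t hlt)
    rw [e1, curveVelocity_comp (hσd t ht') hlt, curveVelocity_comp (hfd t ht') hlt, hld]
    rfl
  rw [hβl, key, neg_add_rev, Circle.exp_add, mul_smul]
  simp [l]

/-- The local transport property of a function determines its derivative; it is smooth. -/
theorem contDiffOn_of_transport {A : EM → EM →L[ℝ] ℝ} {V : Set EM} (hV : IsOpen V)
    (hA : ContDiffOn ℝ ∞ A V) {z : EM → Circle}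
    (hz : ∀ u ∈ V, ∀ u' ∈ V, z u' = Circle.exp (-∫ᶜ v in .segment u u', A v) * z u) :
    ContDiffOn ℝ ∞ (fun u ↦ (z u : ℂ)) V := by
  have hd : ∀ u ∈ V, HasFDerivAt (fun u ↦ (z u : ℂ))
      ((-Complex.I * z u) • Complex.ofRealCLM.comp (A u)) u := by
    intro u hu
    -- Only the derivative at the fixed starting point `u` of the segments is needed, so `A` need
    -- not be closed.
    have h1 : HasFDerivAt (∫ᶜ v in .segment u ·, A v) (A u) u := by
      refine HasFDerivAt.curveIntegral_segment_source' ?_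
      filter_upwards [hV.mem_nhds hu] with v hv
      exact hA.continuousOn.continuousAt (hV.mem_nhds hv)
    have h2 : HasFDerivAt (fun u' ↦ ((∫ᶜ v in .segment u u', A v : ℝ) : ℂ))
      (Complex.ofRealCLM.comp (A u)) u := Complex.ofRealCLM.hasFDerivAt.comp u h1
    have h3 := ((h2.const_mul (-Complex.I)).cexp).mul_const (z u : ℂ)
    have h4 : (∫ᶜ v in .segment u u, A v) = 0 := by
      rw [curveIntegral_segment]; simp
    refine (h3.congr_of_eventuallyEq ?_).congr_fderiv ?_
    · filter_upwards [hV.mem_nhds hu] with u' hu'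
      rw [hz u hu u' hu', Circle.coe_mul, Circle.coe_exp]
      congr 2
      push_cast
      ring
    · ext v
      simp
      ring
  have hdiff : DifferentiableOn ℝ (fun u ↦ (z u : ℂ)) V := fun u hu ↦
    (hd u hu).differentiableAt.differentiableWithinAt
  -- Bootstrapping: in `dz = -i z A` the right side is `C^n` when `z` is, so `z` is `C^(n+1)`.
  rw [contDiffOn_infty]
  intro n
  induction n with
  | zero => exact contDiffOn_zero.2 hdiff.continuousOn
  | succ n ih =>
    push_cast
    refine (contDiffOn_succ_iff_fderiv_of_isOpen hV).2 ⟨hdiff, fun h ↦ absurd h (by simp), ?_⟩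
    refine ContDiffOn.congr ?_ fun u hu ↦ (hd u hu).fderiv
    exact (contDiffOn_const.mul ih).smul
      (contDiffOn_const.clm_comp (hA.of_le (by exact_mod_cast le_top)))

end LocalTransport

/-! ### From the holonomy formula to an equivariant section and trivialization. -/

section EquivariantSection

open Relation

variable {EM : Type*} [NormedAddCommGroup EM] [NormedSpace ℝ EM]
  {M : Type*} [TopologicalSpace M] [ChartedSpace EM M] [IsManifold 𝓘(ℝ, EM) ∞ M]
  {EP : Type*} [NormedAddCommGroup EP] [NormedSpace ℝ EP]
  {P : Type*} [TopologicalSpace P] [ChartedSpace EP P] [IsManifold 𝓘(ℝ, EP) ∞ P]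
  [MulAction Circle P] {p : P → M} {Ξ : OneForm EP P ℂ} {β : OneForm EM M ℝ}

/-- Nearby points of the base are joined by transport steps. -/
theorem exists_transportStep_local (hp : IsPrincipalCircleBundle EM EP p)
    (hΞ : IsCircleConnection Ξ) (hβ : β.IsSmooth) (x : M) :
    ∃ N : Set M, IsOpen N ∧ x ∈ N ∧ ∀ x' ∈ N, ∀ y : P, p y ∈ N →
      ∃ y', TransportStep p Ξ β y y' ∧ p y' = x' := by
  obtain ⟨V, σ, hV, hVc, hxV, hVt, hσ, hpσ⟩ := hp.exists_localSection x
  set e := chartAt EM x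
  have he : ContMDiffOn 𝓘(ℝ, EM) 𝓘(ℝ, EM) ∞ e.symm V :=
    (contMDiffOn_chart_symm (I := 𝓘(ℝ, EM)) (n := ∞) (x := x)).mono hVt
  refine ⟨e.source ∩ e ⁻¹' V, e.isOpen_inter_preimage hV, ⟨mem_chart_source EM x, hxV⟩,
    fun x' hx' y hy ↦ ?_⟩
  have h1 : p (σ (e (p y))) = p y := (hpσ _ hy.2).trans (e.left_inv hy.1)
  have h2 := transportStep_segment hp hΞ hβ hV hVc hσ he hpσ hy.2 hx'.2 (fiberDiv (σ (e (p y))) y)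
  rw [hp.fiberDiv_smul h1] at h2
  exact ⟨_, h2, by rw [hp.proj_smul, hp.proj_smul, hpσ _ hx'.2, e.left_inv hx'.1]⟩

/-- The set of base points reached from `y` is clopen: a neighbourhood `N` as in
`exists_transportStep_local` lies inside it as soon as it meets it. -/
theorem exists_reflTransGen_transportStep [PreconnectedSpace M]
    (hp : IsPrincipalCircleBundle EM EP p) (hΞ : IsCircleConnection Ξ) (hβ : β.IsSmooth)
    (y : P) (x : M) : ∃ y', ReflTransGen (TransportStep p Ξ β) y y' ∧ p y' = x := by
  let T : Set M := {x | ∃ y', ReflTransGen (TransportStep p Ξ β) y y' ∧ p y' = x}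
  have hT : ∀ x : M, ∃ N : Set M, IsOpen N ∧ x ∈ N ∧ ((N ∩ T).Nonempty → N ⊆ T) := by
    intro x
    obtain ⟨N, hN, hx, h⟩ := exists_transportStep_local hp hΞ hβ x
    refine ⟨N, hN, hx, ?_⟩
    rintro ⟨_, hx', y', hy', rfl⟩ x'' hx''
    obtain ⟨y'', h1, h2⟩ := h x'' hx'' y' hx'
    exact ⟨y'', hy'.tail h1, h2⟩
  have hclopen : IsClopen T := by
    constructor
    · refine isClosed_of_closure_subset fun x hx ↦ ?_
      obtain ⟨N, hN, hxN, h⟩ := hT x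
      exact h (mem_closure_iff.1 hx N hN hxN) hxN
    · refine isOpen_iff_mem_nhds.2 fun x hx ↦ ?_
      obtain ⟨N, hN, hxN, h⟩ := hT x
      exact Filter.mem_of_superset (hN.mem_nhds hxN) (h ⟨x, hxN, hx⟩)
  exact (hclopen.eq_univ ⟨p y, y, .refl, rfl⟩).superset (mem_univ x)

/-- If the holonomy is given by an invariant form, the bundle has an equivariant section. -/
theorem exists_equivariant_section [ConnectedSpace M]
    (hp : IsPrincipalCircleBundle EM EP p) (hΞ : IsCircleConnection Ξ) (hβ : β.IsSmooth)
    {G : Type*} [Monoid G] [MulAction G M] [MulAction G P]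
    (hpG : ∀ (φ : G) (y : P), p (φ • y) = φ • p y)
    (hcomm : ∀ (φ : G) (z : Circle) (y : P), φ • z • y = z • φ • y)
    (hol : ∀ (φ : G), ∀ γ ∈ twistedLoops EM M φ,
      equivariantHolonomy p Ξ φ γ = Circle.exp (2 * Real.pi * β.lineIntegral γ)) :
    ∃ s : M → P, ContMDiff 𝓘(ℝ, EM) 𝓘(ℝ, EP) ∞ s ∧ (∀ x, p (s x) = x) ∧
      ∀ (φ : G) (x : M), s (φ • x) = φ • s x := by
  obtain ⟨y₀, -⟩ := hp.proj_surjective (Classical.arbitrary M)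
  have hend : ∀ (φ : G) {y y' : P}, ReflTransGen (TransportStep p Ξ β) y y' →
      p y' = φ • p y → y' = φ • y := fun φ _ _ ↦
    eq_smul_of_reflTransGen_transportStep hp hΞ hβ hpG hcomm hol
  -- No curve is reversed. Transport `y` on to the fibre of `y₀`; the loop through `y₀` closes up,
  -- so `y₀` is reached from `y`. Then `y` to `y₀` to `y'` is a loop as well and gives `y' = y`.
  have huniq : ∀ y y', ReflTransGen (TransportStep p Ξ β) y₀ y →
      ReflTransGen (TransportStep p Ξ β) y₀ y' → p y = p y' → y = y' := by
    intro y y' h h' hyy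
    obtain ⟨y₁, h1, h2⟩ := exists_reflTransGen_transportStep hp hΞ hβ y (p y₀)
    have h3 := hend 1 (h.trans h1) (by rw [h2, one_smul])
    rw [one_smul] at h3
    rw [h3] at h1
    have h4 := hend 1 (h1.trans h') (by rw [hyy, one_smul])
    rw [h4, one_smul]
  choose s hs hps using exists_reflTransGen_transportStep hp hΞ hβ y₀
  refine ⟨s, fun x ↦ ?_, hps, fun φ x ↦ ?_⟩
  · obtain ⟨V, σ, hV, hVc, hxV, hVt, hσ, hpσ⟩ := hp.exists_localSection x
    set e := chartAt EM x
    have he : ContMDiffOn 𝓘(ℝ, EM) 𝓘(ℝ, EM) ∞ e.symm V :=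
      (contMDiffOn_chart_symm (I := 𝓘(ℝ, EM)) (n := ∞) (x := x)).mono hVt
    set z : EM → Circle := fun u ↦ fiberDiv (σ u) (s (e.symm u)) with hz
    have hzs : ∀ u ∈ V, z u • σ u = s (e.symm u) := fun u hu ↦
      hp.fiberDiv_smul (by rw [hpσ u hu, hps])
    -- Transport from `y₀` continued along the segment reaches a point over the parameter `u'`;
    -- `huniq` identifies it with the value of `s` there.
    have hzt : ∀ u ∈ V, ∀ u' ∈ V, z u' =
        Circle.exp (-∫ᶜ v in .segment u u', localConnectionForm Ξ β σ e.symm v) * z u := by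
      intro u hu u' hu'
      have h1 := transportStep_segment hp hΞ hβ hV hVc hσ he hpσ hu hu' (z u)
      rw [hzs u hu] at h1
      refine hp.smul_left_cancel (y := σ u') ?_
      rw [hzs u' hu', mul_smul]
      refine huniq _ _ (hs _) ((hs _).tail h1) ?_
      rw [hp.proj_smul, hp.proj_smul, hps, hpσ u' hu']
    have hzd := contDiffOn_of_transport hV
      (contDiffOn_localConnectionForm hΞ.smooth hβ hV hσ he) hzt
    have hnV : V ∈ 𝓝 (e x) := hV.mem_nhds hxV
    have hzc : ContMDiffAt 𝓘(ℝ, EM) (𝓡 1) ∞ z (e x) :=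
      contMDiffAt_circle_of_coe (contMDiffAt_iff_contDiffAt.2 (hzd.contDiffAt hnV))
    have hec : ContMDiffAt 𝓘(ℝ, EM) 𝓘(ℝ, EM) ∞ e x :=
      (contMDiffOn_chart (I := 𝓘(ℝ, EM)) (n := ∞) (x := x)).contMDiffAt
        (chart_source_mem_nhds EM x)
    have h1 : ContMDiffAt 𝓘(ℝ, EM) 𝓘(ℝ, EP) ∞ (fun u ↦ z u • σ u) (e x) :=
      (hp.smooth_smul.contMDiff_smul.contMDiffAt).comp (e x) (hzc.prodMk (hσ.contMDiffAt hnV))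
    refine (h1.comp x hec).congr_of_eventuallyEq ?_
    filter_upwards [hec.continuousAt.preimage_mem_nhds hnV, chart_source_mem_nhds EM x] with x' h2 h3
    rw [Function.comp_apply, hzs _ h2, e.left_inv h3]
  -- Transport from `s x` to the fibre over `φ • x` ends at `φ • s x`; being reached from `y₀`, this
  -- point is also `s (φ • x)`.
  · obtain ⟨y, h1, h2⟩ := exists_reflTransGen_transportStep hp hΞ hβ (s x) (φ • x)
    rw [← hend φ h1 (by rw [h2, hps])]
    exact huniq _ _ (hs _) ((hs x).trans h1) (by rw [hps, h2])

omit [IsManifold 𝓘(ℝ, EM) ∞ M] [IsManifold 𝓘(ℝ, EP) ∞ P] in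
/-- An equivariant section trivializes the bundle. -/
theorem isTrivialEquivariantCircleBundle_of_section (hp : IsPrincipalCircleBundle EM EP p)
    {G : Type*} [SMul G M] [SMul G P]
    (hcomm : ∀ (φ : G) (z : Circle) (y : P), φ • z • y = z • φ • y) {s : M → P}
    (hs : ContMDiff 𝓘(ℝ, EM) 𝓘(ℝ, EP) ∞ s) (hps : ∀ x, p (s x) = x)
    (hsG : ∀ (φ : G) (x : M), s (φ • x) = φ • s x) :
    IsTrivialEquivariantCircleBundle EM EP G p := by
  refine ⟨⟨⟨fun q ↦ q.2 • s q.1, fun y ↦ (p y, fiberDiv (s (p y)) y), fun q ↦ ?_, fun y ↦ ?_⟩,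
    ?_, ?_⟩, fun x u ↦ ?_, fun x u z ↦ ?_, fun φ x u ↦ ?_⟩
  · simp only [hp.proj_smul, hps, hp.fiberDiv_smul_self]
  · exact hp.fiberDiv_smul (hps _)
  · exact hp.smooth_smul.contMDiff_smul.comp (contMDiff_snd.prodMk (hs.comp contMDiff_fst))
  · refine hp.smooth_proj.prodMk fun y ↦ ?_
    exact (hp.contMDiffWithinAt_fiberDiv (n := ⊤) (mem_univ y)
      (hs.comp hp.smooth_proj).contMDiffAt.contMDiffWithinAt
      contMDiffAt_id.contMDiffWithinAt fun y _ ↦ hps _).contMDiffAt Filter.univ_mem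
  · exact (hp.proj_smul u _).trans (hps x)
  · change (u * z) • s x = z • u • s x
    rw [mul_comm, mul_smul]
  · change u • s (φ • x) = φ • u • s x
    rw [hsG, hcomm]

end EquivariantSection

/-! ### The equivalence. -/

theorem mainTheorem2
    {EM : Type*} [NormedAddCommGroup EM] [NormedSpace ℝ EM] [FiniteDimensional ℝ EM]
    {M : Type*} [TopologicalSpace M] [ChartedSpace EM M] [IsManifold 𝓘(ℝ, EM) ∞ M]
    [T2Space M] [SecondCountableTopology M] [ConnectedSpace M]
    {EG : Type*} [NormedAddCommGroup EG] [NormedSpace ℝ EG] [FiniteDimensional ℝ EG]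
    {G : Type*} [TopologicalSpace G] [ChartedSpace EG G] [Group G] [LieGroup 𝓘(ℝ, EG) ∞ G]
    {EP : Type*} [NormedAddCommGroup EP] [NormedSpace ℝ EP] [FiniteDimensional ℝ EP]
    {P : Type*} [TopologicalSpace P] [ChartedSpace EP P] [IsManifold 𝓘(ℝ, EP) ∞ P]
    [MulAction G M] [ContMDiffSMul 𝓘(ℝ, EG) 𝓘(ℝ, EM) ∞ G M]
    [MulAction G P] [MulAction Circle P]
    (p : P → M) (hp : IsEquivariantCircleBundle EM EP EG G p)
    (Ξ : OneForm EP P ℂ) (hΞ : IsCircleConnection Ξ) (hinv : Ξ.IsInvariant G) :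
    IsTrivialEquivariantCircleBundle EM EP G p ↔
      ∃ β : OneForm EM M ℝ, β.IsSmooth ∧ β.IsInvariant G ∧
        ∀ (φ : G), ∀ γ ∈ twistedLoops EM M φ,
          equivariantHolonomy p Ξ φ γ = Circle.exp (2 * Real.pi * β.lineIntegral γ) := by
  have hb := hp.toIsPrincipalCircleBundle
  constructor
  · rintro ⟨Φ, hpΦ, -, hΦG⟩
    -- The image of the unit section of `M × Circle` is the equivariant section.
    have hs : ContMDiff 𝓘(ℝ, EM) 𝓘(ℝ, EP) ∞ (fun x ↦ Φ (x, 1)) :=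
      Φ.contMDiff_toFun.comp (contMDiff_id.prodMk contMDiff_const)
    have hM : ∀ φ : G, ContMDiff 𝓘(ℝ, EM) 𝓘(ℝ, EM) ∞ (fun x : M ↦ φ • x) := fun φ ↦
      (contMDiff_smul (I := 𝓘(ℝ, EG)) (I' := 𝓘(ℝ, EM)) (n := ∞) (G := G) (M := M)).comp
        (contMDiff_const.prodMk contMDiff_id)
    have hP : ∀ φ : G, ContMDiff 𝓘(ℝ, EP) 𝓘(ℝ, EP) ∞ (fun y : P ↦ φ • y) := fun φ ↦
      hp.smooth_group_smul.contMDiff_smul.comp (contMDiff_const.prodMk contMDiff_id)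
    exact ⟨sectionForm EM Ξ fun x ↦ Φ (x, 1), sectionForm_isSmooth hΞ.smooth hs,
      sectionForm_isInvariant hM hP hinv hs fun φ x ↦ hΦG φ x 1,
      fun φ γ hγ ↦ equivariantHolonomy_eq_of_section hb hΞ hp.group_smul_comm hs
        (fun x ↦ hpΦ x 1) (fun φ x ↦ hΦG φ x 1) hγ⟩
  · rintro ⟨β, hβ, -, hol⟩
    obtain ⟨s, hs, hps, hsG⟩ := exists_equivariant_section hb hΞ hβ hp.proj_group_smul
      hp.group_smul_comm hol
    exact isTrivialEquivariantCircleBundle_of_section hb hp.group_smul_comm hs hps hsG
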